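/- Let $H$ be a real Hilbert space and let $F:H\to H$ be compact (continuous, mapping bounded sets to relatively compact sets) and twice Fréchet differentiable, with $\|F'(x)\|\le N_1$ and $\|F''(x)\|\le N_2$ for all $x\in H$, where $N_2>0$. Suppose that the equation $F(z)=0$ has a unique solution $y\in H$. For $h\in H$ and $\varepsilon>0$ put $T(h):=F'(h)^*F'(h)$ and $T_\varepsilon(h):=T(h)+\varepsilon I$. Fix $\xi,z_0\in H$, let $P_\varepsilon(\xi):=\int_{[\varepsilon,N_1^2]}dE(s)$, where $E$ is the resolution of the identity of the compact self-adjoint operator $T(\xi)$ (that is, $P_\varepsilon(\xi)$ is the orthogonal projection onto the closed span of the eigenvectors of $T(\xi)$ with eigenvalues in $[\varepsilon,N_1^2]$), and, for a function $\varepsilon(t)>0$ on $[0,\infty)$, let $$\Phi(h,t):=(P_{\varepsilon(t)}(\xi)-I)(h-z_0)-P_{\varepsilon(t)}(\xi)\,T_{\varepsilon(t)}^{-1}(h)\,F'(h)^*F(h).$$ Assume that for some $\varepsilon_0>0$ one has $0<\varepsilon(t)\le\varepsilon_0$ for all $t\ge 0$ and $$C:=\sup_{\varepsilon\in(0,\varepsilon_0]}\bigl\|P_\varepsilon(\xi)T_\varepsilon^{-1}(\xi)\{T(y)-T(\xi)\}\bigr\|<\tfrac12,$$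 and put $\gamma:=\tfrac12-C$ and $\alpha(t):=\|(P_{\varepsilon(t)}(\xi)-I)(y-z_0)\|$. Suppose moreover that: 1. $P(y-z_0)=0$, where $P$ is the orthogonal projector onto the null space of $T(\xi)$; 2. $\varepsilon(t)$ is continuously differentiable on $[0,\infty)$, is non-increasing, tends to $0$ as $t\to\infty$, and $C_0:=\inf_{t\ge 0}\{\gamma-|\dot\varepsilon(t)|/\varepsilon(t)\}>0$; 3. $C_\alpha:=\varepsilon(0)\sup_{t\ge 0}\{\alpha(t)/\varepsilon(t)\}<\infty$; 4. $\displaystyle\frac{4N_1N_2+N_2\sqrt{\varepsilon(0)}}{2C_0}<\varepsilon(0)\min\Bigl\{\frac{C_0}{2C_\alpha},\frac1{\|y-z_0\|}\Bigr\}$, where a quotient with denominator $0$ is read as $+\infty$. Then the Cauchy problem $\dot z(t)=\Phi(z(t),t)$, $z(0)=z_0$, has a unique solution $z$ on $[0,\infty)$, in the sense that $z$ is continuous on $[0,\infty)$, $s\mapsto\Phi(z(s),s)$ is Bochner integrable on bounded intervals, and $z(t)=z_0+\int_0^t\Phi(z(s),s)\,ds$ for all $t\ge 0$. For this solution, the right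 derivative of $z$ equals $\Phi(z(t),t)$ at every $t\ge 0$, $\dot z(t)=\Phi(z(t),t)$ as a two-sided derivative at every $t>0$ for which $\varepsilon(t)$ is not an eigenvalue of $T(\xi)$, and $$\|z(t)-y\|\le\frac{2C_0}{4N_1N_2+N_2\sqrt{\varepsilon(0)}}\,\varepsilon(t)\qquad\text{for all }t\ge 0.$$ -/

import Mathlib

open Set Filter Topology MeasureTheory

noncomputable section

namespace GaussNewton

variable {H : Type*} [NormedAddCommGroup H] [InnerProductSpace ℝ H] [CompleteSpace H]

/-- A (possibly nonlinear) compact operator: continuous, and it maps bounded sets to relatively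
compact sets. -/
def IsCompactMap (F : H → H) : Prop :=
  Continuous F ∧ ∀ B : Set H, Bornology.IsBounded B → IsCompact (closure (F '' B))

/-- `T(h) = F'(h)* F'(h)`. -/
def T (F : H → H) (h : H) : H →L[ℝ] H :=
  ContinuousLinearMap.adjoint (fderiv ℝ F h) ∘L fderiv ℝ F h

/-- `(T(h) + ε I)⁻¹`; for `ε > 0` the operator `T(h) + ε I` is boundedly invertible, since `T(h)`
is nonnegative and self-adjoint. -/
def TepsInv (F : H → H) (ε : ℝ) (h : H) : H →L[ℝ] H :=
  Ring.inverse (T F h + ε • (1 : H →L[ℝ] H))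

/-- The spectral measure `∫_B dE(s)` of a compact self-adjoint operator `A`, where `E` is the
resolution of the identity of `A`. The spectrum of such an operator being pure point,
this is the orthogonal projection onto the closed linear span of the eigenvectors of `A` with
eigenvalue in `B`. -/
def spectralProj (A : H →L[ℝ] H) (B : Set ℝ) : H →L[ℝ] H :=
  (⨆ s ∈ B, Module.End.eigenspace (A : H →ₗ[ℝ] H) s).topologicalClosure.starProjection

/-- `P_ε(ξ) = ∫_ε^{N₁²} dE(s)`, with `E` the resolution of the identity of `T(ξ)` (both end points
are included). -/
def P (F : H → H) (N₁ : ℝ) (ξ : H) (ε : ℝ) : H →L[ℝ] H :=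
  spectralProj (T F ξ) (Icc ε (N₁ ^ 2))

/-- `Φ(h,t) = (P_{ε(t)}(ξ) - I)(h - z₀) - P_{ε(t)}(ξ) (T(h) + ε(t) I)⁻¹ F'(h)* F(h)`. -/
def Phi (F : H → H) (N₁ : ℝ) (ξ z₀ : H) (ε : ℝ → ℝ) (h : H) (t : ℝ) : H :=
  (P F N₁ ξ (ε t) - 1) (h - z₀)
    - P F N₁ ξ (ε t) (TepsInv F (ε t) h (ContinuousLinearMap.adjoint (fderiv ℝ F h) (F h)))

/-- `z` is a solution on `[0,∞)` of the Cauchy problem `ż(t) = Φ(z(t),t)`, `z(0) = z₀`, where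
`Φ` may be discontinuous in `t`: `z` is continuous, `s ↦ Φ(z(s),s)` is Bochner integrable
on bounded intervals, and `z(t) = z₀ + ∫₀ᵗ Φ(z(s),s) ds` for all `t ≥ 0`. -/
structure IsSolution (Φ : H → ℝ → H) (z₀ : H) (z : ℝ → H) : Prop where
  continuousOn : ContinuousOn z (Ici 0)
  integrable : ∀ t, 0 ≤ t → IntervalIntegrable (fun s => Φ (z s) s) volume 0 t
  eq_integral : ∀ t, 0 ≤ t → z t = z₀ + ∫ s in (0 : ℝ)..t, Φ (z s) s

end GaussNewton

end

namespace GaussNewton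

/-! ### The operators `T` and `TepsInv`, and the spectral projections of `T F ξ`. -/

section Operators

variable {H : Type*} [NormedAddCommGroup H] [InnerProductSpace ℝ H] [CompleteSpace H]

local notation "⟪" x ", " y "⟫" => inner ℝ x y

/-! Put w = z − y. Substituting F(z) = F'(z)w + K, with ‖K‖ ≤ N₂‖w‖²/2, turns the field into −w + (P
− I)(y − z₀) + εP T_ε⁻¹(z)w − P T_ε⁻¹(z)F'(z)*K. On the range of P the operator T(ξ) is at least ε,
so ‖εP T_ε⁻¹(ξ)‖ ≤ 1/2; replacing T(ξ) by T(y) costs C, and T(y) by T(z) costs N₁N₂‖w‖/ε. Together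
with ‖T_ε⁻¹F'*‖ ≤ 1/(2√ε) this gives ⟨w, ż⟩ ≤ ‖w‖(α − γ‖w‖ + (4N₁N₂ + N₂√ε)‖w‖²/(4ε)), which is
`inner_sub_field_le`. Conditions 2–4 then make vε(t), with v = 2C₀/(4N₁N₂ + N₂√ε(0)), a strict upper
barrier for ‖w‖ (`norm_sub_le_mul_of_hasDerivWithinAt`).

Well-posedness is delicate because the field may jump in t when ε(t) meets an eigenvalue of T(ξ).
Compactness of F leaves only finitely many eigenvalues above any positive level
(`finite_eigenvalues_ge`). Since ε is non-increasing and the spectral interval is closed at ε, the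
field is right-continuous along continuous curves (`continuousWithinAt_Ici_Phi`). Picard iteration
(`exists_integral_solution`) solves the equation truncated to the ball of radius vε(0) about y; the
barrier keeps the solution inside, so the truncation never acts. The barrier also confines every
other solution to that ball, where the field is Lipschitz, whence uniqueness. -/

theorem inner_T_left (F : H → H) (h u v : H) :
    ⟪T F h u, v⟫ = ⟪fderiv ℝ F h u, fderiv ℝ F h v⟫ := by
  simp [T, ContinuousLinearMap.adjoint_inner_left]

theorem inner_T_right (F : H → H) (h u v : H) :
    ⟪u, T F h v⟫ = ⟪fderiv ℝ F h u, fderiv ℝ F h v⟫ := by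
  simp [T, ContinuousLinearMap.adjoint_inner_right]

theorem T_isSymmetric (F : H → H) (h : H) : (T F h : H →ₗ[ℝ] H).IsSymmetric := fun u v => by
  simp only [ContinuousLinearMap.coe_coe]
  rw [inner_T_left, inner_T_right]

theorem inner_T_self (F : H → H) (h u : H) : ⟪T F h u, u⟫ = ‖fderiv ℝ F h u‖ ^ 2 := by
  rw [inner_T_left, real_inner_self_eq_norm_sq]

theorem inner_Teps_self (F : H → H) (e : ℝ) (h u : H) :
    ⟪(T F h + e • (1 : H →L[ℝ] H)) u, u⟫ = ‖fderiv ℝ F h u‖ ^ 2 + e * ‖u‖ ^ 2 := by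
  simp [inner_add_left, inner_T_self, inner_smul_left]

theorem isUnit_Teps (F : H → H) {e : ℝ} (he : 0 < e) (h : H) :
    IsUnit (T F h + e • (1 : H →L[ℝ] H)) := by
  refine ContinuousLinearMap.isUnit_of_forall_le_norm_inner_map _ (c := ⟨e, he.le⟩) he fun x => ?_
  rw [inner_Teps_self, Real.norm_eq_abs]
  refine le_trans ?_ (le_abs_self _)
  change ‖x‖ ^ 2 * e ≤ _
  nlinarith [sq_nonneg ‖fderiv ℝ F h x‖]

theorem Teps_mul_TepsInv (F : H → H) {e : ℝ} (he : 0 < e) (h : H) :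
    (T F h + e • (1 : H →L[ℝ] H)) * TepsInv F e h = 1 :=
  Ring.mul_inverse_cancel _ (isUnit_Teps F he h)

theorem TepsInv_mul_Teps (F : H → H) {e : ℝ} (he : 0 < e) (h : H) :
    TepsInv F e h * (T F h + e • (1 : H →L[ℝ] H)) = 1 :=
  Ring.inverse_mul_cancel _ (isUnit_Teps F he h)

theorem Teps_TepsInv_apply (F : H → H) {e : ℝ} (he : 0 < e) (h x : H) :
    (T F h + e • (1 : H →L[ℝ] H)) (TepsInv F e h x) = x :=
  congrArg (fun A : H →L[ℝ] H => A x) (Teps_mul_TepsInv F he h)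

theorem TepsInv_T_apply (F : H → H) {e : ℝ} (he : 0 < e) (h x : H) :
    TepsInv F e h (T F h x) = x - e • TepsInv F e h x := by
  have := congrArg (fun A : H →L[ℝ] H => A x) (TepsInv_mul_Teps F he h)
  rw [eq_sub_iff_add_eq, ← map_smul, ← map_add]
  exact this

theorem norm_TepsInv_apply_le (F : H → H) {e : ℝ} (he : 0 < e) (h x : H) :
    ‖TepsInv F e h x‖ ≤ e⁻¹ * ‖x‖ := by
  set u := TepsInv F e h x with hu
  have h1 := inner_Teps_self F e h u
  rw [Teps_TepsInv_apply F he] at h1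
  have h2 := real_inner_le_norm x u
  rw [le_inv_mul_iff₀ he]
  rcases (norm_nonneg u).eq_or_lt with h0 | h0
  · rw [← h0]; simp
  · refine le_of_mul_le_mul_right ?_ h0
    nlinarith [sq_nonneg ‖fderiv ℝ F h u‖]

/-- Pairing T_ε u = F'*k with u gives ‖F'u‖² + ε‖u‖² = ⟨k, F'u⟩ ≤ ‖k‖‖F'u‖, and the left side is at
least 2√ε‖u‖‖F'u‖. This gains √ε over bounding the two factors separately. -/
theorem norm_TepsInv_adjoint_apply_le (F : H → H) {e : ℝ} (he : 0 < e) (h k : H) :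
    ‖TepsInv F e h (ContinuousLinearMap.adjoint (fderiv ℝ F h) k)‖ ≤ ‖k‖ / (2 * √e) := by
  set x := ContinuousLinearMap.adjoint (fderiv ℝ F h) k with hx
  set u := TepsInv F e h x with hu
  have h1 := inner_Teps_self F e h u
  rw [Teps_TepsInv_apply F he, hx, ContinuousLinearMap.adjoint_inner_left] at h1
  have h2 := real_inner_le_norm k (fderiv ℝ F h u)
  have hs : 0 < √e := Real.sqrt_pos.2 he
  have hs2 : √e ^ 2 = e := Real.sq_sqrt he.le
  rw [le_div_iff₀ (by positivity)]
  rcases (norm_nonneg (fderiv ℝ F h u)).eq_or_lt with h0 | h0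
  · rw [← h0] at h1 h2
    have : ‖u‖ ^ 2 ≤ 0 := by
      have : e * ‖u‖ ^ 2 ≤ 0 := by nlinarith
      exact nonpos_of_mul_nonpos_right this he
    have : ‖u‖ = 0 := by nlinarith [norm_nonneg u]
    rw [this]; simp
  · refine le_of_mul_le_mul_right ?_ h0
    nlinarith [sq_nonneg (‖fderiv ℝ F h u‖ - √e * ‖u‖)]

/-- Resolvent identity; the shift ε cancels in the difference. -/
theorem TepsInv_sub_TepsInv (F : H → H) {e : ℝ} (he : 0 < e) (h h' : H) :
    TepsInv F e h - TepsInv F e h' = TepsInv F e h' * (T F h' - T F h) * TepsInv F e h := by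
  have h1 := TepsInv_mul_Teps F he h'
  have h2 := Teps_mul_TepsInv F he h
  calc TepsInv F e h - TepsInv F e h'
      = (TepsInv F e h' * (T F h' + e • (1 : H →L[ℝ] H))) * TepsInv F e h
        - TepsInv F e h' * ((T F h + e • (1 : H →L[ℝ] H)) * TepsInv F e h) := by
          rw [h1, h2, one_mul, mul_one]
    _ = _ := by
      rw [mul_assoc, ← mul_sub, ← sub_mul, add_sub_add_right_eq_sub, mul_assoc]

/-! ### Consequences of the bounds on F' and F''. -/

section Bounds

variable {F : H → H} {N₁ N₂ : ℝ}

omit [CompleteSpace H] in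
theorem norm_fderiv_sub_le (hF' : Differentiable ℝ (fderiv ℝ F))
    (hN₂ : ∀ x, ‖fderiv ℝ (fderiv ℝ F) x‖ ≤ N₂) (h h' : H) :
    ‖fderiv ℝ F h - fderiv ℝ F h'‖ ≤ N₂ * ‖h - h'‖ :=
  convex_univ.norm_image_sub_le_of_norm_fderiv_le (fun x _ => hF' x) (fun x _ => hN₂ x)
    (mem_univ _) (mem_univ _)

theorem norm_T_sub_le (hN₁ : ∀ x, ‖fderiv ℝ F x‖ ≤ N₁) (hF' : Differentiable ℝ (fderiv ℝ F))
    (hN₂ : ∀ x, ‖fderiv ℝ (fderiv ℝ F) x‖ ≤ N₂) (h h' : H) :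
    ‖T F h - T F h'‖ ≤ 2 * N₁ * N₂ * ‖h - h'‖ := by
  have hd := norm_fderiv_sub_le hF' hN₂ h h'
  have h0 : 0 ≤ N₁ := (norm_nonneg _).trans (hN₁ h)
  have e : T F h - T F h' =
      ContinuousLinearMap.adjoint (fderiv ℝ F h) ∘L (fderiv ℝ F h - fderiv ℝ F h')
      + ContinuousLinearMap.adjoint (fderiv ℝ F h - fderiv ℝ F h') ∘L fderiv ℝ F h' := by
    ext x; simp [T]
  rw [e]
  calc _ ≤ ‖ContinuousLinearMap.adjoint (fderiv ℝ F h)‖ * ‖fderiv ℝ F h - fderiv ℝ F h'‖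
        + ‖ContinuousLinearMap.adjoint (fderiv ℝ F h - fderiv ℝ F h')‖ * ‖fderiv ℝ F h'‖ :=
        (norm_add_le _ _).trans (add_le_add (ContinuousLinearMap.opNorm_comp_le _ _)
          (ContinuousLinearMap.opNorm_comp_le _ _))
    _ ≤ N₁ * (N₂ * ‖h - h'‖) + (N₂ * ‖h - h'‖) * N₁ := by
        simp only [LinearIsometryEquiv.norm_map]
        have := hd.trans' (norm_nonneg _)
        gcongr
        · exact hN₁ h
        · exact hN₁ h'
    _ = _ := by ring

-- Taylor's formula at h, read along the segment to y: the remainder g has ‖g'(t)‖ ≤ N₂‖w‖²t, and is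
-- compared with the primitive N₂‖w‖²t²/2.
omit [CompleteSpace H] in
theorem norm_remainder_le (hF : Differentiable ℝ F) (hF' : Differentiable ℝ (fderiv ℝ F))
    (hN₂ : ∀ x, ‖fderiv ℝ (fderiv ℝ F) x‖ ≤ N₂) (h y : H) :
    ‖F h - F y - fderiv ℝ F h (h - y)‖ ≤ N₂ / 2 * ‖h - y‖ ^ 2 := by
  set w := y - h with hw
  set g : ℝ → H := fun t => F (h + t • w) - F h - t • fderiv ℝ F h w with hg
  have hgd : ∀ t, HasDerivAt g (fderiv ℝ F (h + t • w) w - fderiv ℝ F h w) t := fun t => by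
    have h1 : HasDerivAt (fun t : ℝ => h + t • w) w t := by
      simpa using ((hasDerivAt_id t).smul_const w).const_add h
    have h2 := (hF (h + t • w)).hasFDerivAt.comp_hasDerivAt t h1
    have h3 : HasDerivAt (fun t : ℝ => t • fderiv ℝ F h w) (fderiv ℝ F h w) t := by
      simpa using (hasDerivAt_id t).smul_const (fderiv ℝ F h w)
    exact (h2.sub_const (F h)).sub h3
  have hB : ∀ t : ℝ, HasDerivAt (fun t : ℝ => N₂ / 2 * ‖w‖ ^ 2 * t ^ 2) (N₂ * ‖w‖ ^ 2 * t) t :=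
    fun t => by
      refine ((hasDerivAt_pow 2 t).const_mul (N₂ / 2 * ‖w‖ ^ 2)).congr_deriv ?_
      rw [Nat.add_one_sub_one, pow_one]; push_cast; ring
  have key := image_norm_le_of_norm_deriv_right_le_deriv_boundary (f := g) (a := 0) (b := 1)
    (B := fun t : ℝ => N₂ / 2 * ‖w‖ ^ 2 * t ^ 2) (fun t _ => (hgd t).continuousAt.continuousWithinAt)
    (fun t _ => (hgd t).hasDerivWithinAt) (by simp [hg]) hB (fun t ht => by
      rw [← sub_apply]
      have := norm_fderiv_sub_le hF' hN₂ (h + t • w) h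
      rw [add_sub_cancel_left, norm_smul, Real.norm_of_nonneg ht.1] at this
      calc _ ≤ _ := ContinuousLinearMap.le_opNorm _ _
        _ ≤ N₂ * (t * ‖w‖) * ‖w‖ := by gcongr
        _ = _ := by ring)
  have := key (right_mem_Icc.2 zero_le_one)
  have e1 : F h - F y - fderiv ℝ F h (h - y) = -g 1 := by
    have h1 : h - y = -w := (neg_sub y h).symm
    have h2 : h + (1 : ℝ) • w = y := by rw [one_smul, hw, add_sub_cancel]
    rw [h1, map_neg, hg]
    beta_reduce
    rw [h2, one_smul]
    abel
  rw [e1, norm_neg, norm_sub_rev h y]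
  simpa using this

theorem continuous_T (hF' : Differentiable ℝ (fderiv ℝ F)) : Continuous (T F) :=
  (((ContinuousLinearMap.adjoint (𝕜 := ℝ) (E := H) (F := H)).continuous.comp
    hF'.continuous)).clm_comp hF'.continuous

theorem continuousAt_TepsInv (hF' : Differentiable ℝ (fderiv ℝ F)) {e : ℝ} (he : 0 < e) (h : H) :
    ContinuousAt (fun p : ℝ × H => TepsInv F p.1 p.2) (e, h) := by
  obtain ⟨u, hu⟩ := isUnit_Teps F he h
  have h1 := NormedRing.inverse_continuousAt u
  rw [hu] at h1
  have h2 : Continuous (fun p : ℝ × H => T F p.2 + p.1 • (1 : H →L[ℝ] H)) :=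
    ((continuous_T hF').comp continuous_snd).add (continuous_fst.smul continuous_const)
  exact ContinuousAt.comp (f := fun p : ℝ × H => T F p.2 + p.1 • (1 : H →L[ℝ] H))
    (x := (e, h)) h1 h2.continuousAt

end Bounds

/-! ### Spectral projections and local constancy of `P` in ε. -/

section Spectral

theorem norm_spectralProj_apply_le (A : H →L[ℝ] H) (B : Set ℝ) (x : H) :
    ‖spectralProj A B x‖ ≤ ‖x‖ :=
  Submodule.norm_starProjection_apply_le _ x

theorem norm_spectralProj_sub_one_apply_le (A : H →L[ℝ] H) (B : Set ℝ) (x : H) :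
    ‖(spectralProj A B - 1) x‖ ≤ ‖x‖ := by
  have h3 : (spectralProj A B - 1) x = -((⨆ s ∈ B, Module.End.eigenspace
      (A : H →ₗ[ℝ] H) s).topologicalClosureᗮ.starProjection x) := by
    rw [Submodule.starProjection_orthogonal_val]
    simp [spectralProj]
  rw [h3, norm_neg]
  exact Submodule.norm_starProjection_apply_le _ x

omit [CompleteSpace H] in
theorem map_mem_closure_iSup_eigenspace (A : H →L[ℝ] H) (B : Set ℝ) {u : H}
    (hu : u ∈ (⨆ s ∈ B, Module.End.eigenspace (A : H →ₗ[ℝ] H) s).topologicalClosure) :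
    A u ∈ (⨆ s ∈ B, Module.End.eigenspace (A : H →ₗ[ℝ] H) s).topologicalClosure := by
  have hmap : ∀ v ∈ ⨆ s ∈ B, Module.End.eigenspace (A : H →ₗ[ℝ] H) s,
      A v ∈ ⨆ s ∈ B, Module.End.eigenspace (A : H →ₗ[ℝ] H) s := by
    intro v hv
    have : (⨆ s ∈ B, Module.End.eigenspace (A : H →ₗ[ℝ] H) s) ≤
        (⨆ s ∈ B, Module.End.eigenspace (A : H →ₗ[ℝ] H) s).comap (A : H →ₗ[ℝ] H) := by
      refine iSup₂_le fun s hs x hx => ?_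
      have hx' : A x = s • x := Module.End.mem_eigenspace_iff.1 hx
      rw [Submodule.mem_comap, ContinuousLinearMap.coe_coe, hx']
      exact Submodule.smul_mem _ _ (Submodule.mem_iSup_of_mem s (Submodule.mem_iSup_of_mem hs hx))
    exact this hv
  exact map_mem_closure A.continuous hu hmap

-- On finite sums of eigenvectors, orthogonality of the eigenspaces splits both sides eigenvalue by
-- eigenvalue; the inequality is a closed condition.
omit [CompleteSpace H] in
theorem le_inner_map_of_mem_closure (A : H →L[ℝ] H) (hA : (A : H →ₗ[ℝ] H).IsSymmetric)
    {B : Set ℝ} {e : ℝ} (hB : ∀ s ∈ B, e ≤ s) {u : H}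
    (hu : u ∈ (⨆ s ∈ B, Module.End.eigenspace (A : H →ₗ[ℝ] H) s).topologicalClosure) :
    e * ‖u‖ ^ 2 ≤ ⟪A u, u⟫ := by
  have hclosed : IsClosed {u : H | e * ‖u‖ ^ 2 ≤ ⟪A u, u⟫} :=
    isClosed_le (by fun_prop) (by fun_prop)
  refine closure_minimal (s := (⨆ s ∈ B, Module.End.eigenspace (A : H →ₗ[ℝ] H) s : Submodule ℝ H))
    ?_ hclosed (by rwa [← Submodule.topologicalClosure_coe])
  intro v hv
  rw [SetLike.mem_coe, iSup_subtype', Submodule.mem_iSup_iff_exists_finsupp] at hv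
  obtain ⟨f, hf, rfl⟩ := hv
  have hOF := hA.orthogonalFamily_eigenspaces.comp (Subtype.val_injective (p := (· ∈ B)))
  let g : ∀ i : B, Module.End.eigenspace (A : H →ₗ[ℝ] H) i := fun i => ⟨f i, hf i⟩
  have hAf : ∀ i : B, A (f i) = (i : ℝ) • f i := fun i => Module.End.mem_eigenspace_iff.1 (hf i)
  have h1 := hOF.norm_sum g f.support
  have h2 := hOF.inner_sum (fun i => (i : ℝ) • g i) g f.support
  simp only [Submodule.coe_subtypeₗᵢ, Submodule.subtype_apply, g,
    SetLike.mk_smul_mk] at h1 h2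
  simp only [mem_ofPred_eq, Finsupp.sum, map_sum, hAf]
  rw [h2, h1, Finset.mul_sum]
  refine Finset.sum_le_sum fun i _ => ?_
  simp only [Submodule.coe_inner, Submodule.coe_norm, inner_smul_left, real_inner_self_eq_norm_sq,
    RCLike.conj_to_real]
  exact mul_le_mul_of_nonneg_right (hB _ i.2) (by positivity)

/-- The range of P is invariant under T_ε(ξ), so for u = P T_ε⁻¹x symmetry gives ⟨x, u⟩ = ⟨u, T_ε
u⟩. There T ≥ ε, hence T_ε ≥ 2ε: this is the source of the 1/2 in γ. -/
theorem norm_P_TepsInv_apply_le (F : H → H) (N₁ : ℝ) (ξ : H) {e : ℝ} (he : 0 < e) (x : H) :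
    ‖P F N₁ ξ e (TepsInv F e ξ x)‖ ≤ (2 * e)⁻¹ * ‖x‖ := by
  set K := (⨆ s ∈ Icc e (N₁ ^ 2),
    Module.End.eigenspace (T F ξ : H →ₗ[ℝ] H) s).topologicalClosure with hK
  set s := TepsInv F e ξ x with hs
  have hPs : P F N₁ ξ e s = K.starProjection s := rfl
  set u := K.starProjection s with hu
  have huK : u ∈ K := Submodule.starProjection_apply_mem _ _
  have hTu : (T F ξ + e • (1 : H →L[ℝ] H)) u ∈ K := by
    simpa using K.add_mem (map_mem_closure_iSup_eigenspace (T F ξ) _ huK) (K.smul_mem e huK)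
  have h1 : e * ‖u‖ ^ 2 ≤ ⟪T F ξ u, u⟫ :=
    le_inner_map_of_mem_closure _ (T_isSymmetric F ξ) (fun _ hs => hs.1) huK
  have h2 : ⟪x, u⟫ = ⟪s, (T F ξ + e • (1 : H →L[ℝ] H)) u⟫ := by
    conv_lhs => rw [← Teps_TepsInv_apply F he ξ x]
    simp only [add_apply, inner_add_left, inner_add_right, inner_T_left,
      inner_T_right, smul_apply, one_apply_eq_self, inner_smul_left,
      inner_smul_right, hs]
    simp
  have h3 : ⟪s, (T F ξ + e • (1 : H →L[ℝ] H)) u⟫ = ⟪u, (T F ξ + e • (1 : H →L[ℝ] H)) u⟫ := by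
    have := K.starProjection_inner_eq_zero s _ hTu
    rw [inner_sub_left] at this
    linarith
  have h4 : ⟪u, (T F ξ + e • (1 : H →L[ℝ] H)) u⟫ = ⟪T F ξ u, u⟫ + e * ‖u‖ ^ 2 := by
    rw [real_inner_comm]; simp [inner_add_left, inner_smul_left]
  have h5 := real_inner_le_norm x u
  rw [hPs, le_inv_mul_iff₀ (by positivity)]
  rcases (norm_nonneg u).eq_or_lt with h0 | h0
  · rw [← h0]; simp
  · refine le_of_mul_le_mul_right ?_ h0
    nlinarith

theorem spectralProj_Icc_congr (A : H →L[ℝ] H) {e e' b : ℝ} (hle : e' ≤ e)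
    (h : ∀ s ∈ Ico e' e, ¬ Module.End.HasEigenvalue (A : H →ₗ[ℝ] H) s) :
    spectralProj A (Icc e' b) = spectralProj A (Icc e b) := by
  have : (⨆ s ∈ Icc e' b, Module.End.eigenspace (A : H →ₗ[ℝ] H) s) =
      ⨆ s ∈ Icc e b, Module.End.eigenspace (A : H →ₗ[ℝ] H) s := by
    refine le_antisymm (iSup₂_le fun s hs => ?_) (biSup_mono fun s hs => ⟨hle.trans hs.1, hs.2⟩)
    by_cases hse : s < e
    · have := h s ⟨hs.1, hse⟩
      rw [Module.End.hasEigenvalue_iff, not_not] at this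
      rw [this]; exact bot_le
    · exact le_iSup₂_of_le s ⟨not_lt.1 hse, hs.2⟩ le_rfl
  simp only [spectralProj, this]

/-- Infinitely many such eigenvalues would give orthonormal eigenvectors whose images under F'(ξ)
are √(2d)-separated. At a small scale t, F itself then separates the points ξ + t vₙ of a bounded
set, against compactness. -/
theorem finite_eigenvalues_ge {F : H → H} (hF_compact : IsCompactMap F) (hF : Differentiable ℝ F)
    (ξ : H) {d : ℝ} (hd : 0 < d) :
    {s | d ≤ s ∧ Module.End.HasEigenvalue (T F ξ : H →ₗ[ℝ] H) s}.Finite := by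
  by_contra hinf
  let s := Set.Infinite.natEmbedding _ hinf
  have hv : ∀ n, ∃ v : H, ‖v‖ = 1 ∧ T F ξ v = (s n : ℝ) • v := fun n => by
    obtain ⟨v, hv⟩ := (s n).2.2.exists_hasEigenvector
    refine ⟨(‖v‖)⁻¹ • v, norm_smul_inv_norm hv.2, ?_⟩
    have := hv.apply_eq_smul
    simp only [ContinuousLinearMap.coe_coe] at this
    rw [map_smul, this, smul_comm]
  choose v hv1 hvT using hv
  have horth : ∀ m n, m ≠ n → ⟪v m, v n⟫ = 0 := fun m n hmn => by
    have h1 := inner_T_left F ξ (v m) (v n)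
    rw [← inner_T_right, hvT, hvT, inner_smul_left, inner_smul_right] at h1
    have h2 : (s m : ℝ) ≠ s n := fun h => hmn (s.injective (Subtype.ext h))
    have h3 : ((s m : ℝ) - s n) * ⟪v m, v n⟫ = 0 := by
      simp only [RCLike.conj_to_real] at h1; linarith
    exact (mul_eq_zero.1 h3).resolve_left (sub_ne_zero.2 h2)
  have hsep : ∀ m n, m ≠ n → √(2 * d) ≤ ‖fderiv ℝ F ξ (v m) - fderiv ℝ F ξ (v n)‖ := by
    intro m n hmn
    refine Real.sqrt_le_iff.2 ⟨norm_nonneg _, ?_⟩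
    rw [← map_sub, ← inner_T_self, map_sub, hvT, hvT]
    simp only [inner_sub_left, inner_sub_right, inner_smul_left, horth m n hmn,
      horth n m hmn.symm, real_inner_self_eq_norm_sq, hv1]
    have := (s m).2.1
    have := (s n).2.1
    simp; linarith
  set c := √(2 * d) with hc
  have hc0 : 0 < c := Real.sqrt_pos.2 (by positivity)
  -- Two linearisation errors of tc/4 each leave half of the separation tc.
  have hlo := (hF ξ).hasFDerivAt.isLittleO.def (c := c / 4) (by positivity)
  obtain ⟨r, hr, hball⟩ := Metric.eventually_nhds_iff_ball.1 hlo
  set t := r / 2 with ht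
  have ht0 : 0 < t := by positivity
  have hlin : ∀ n, ‖F (ξ + t • v n) - F ξ - t • fderiv ℝ F ξ (v n)‖ ≤ c / 4 * t := fun n => by
    have := hball (ξ + t • v n) (by simp [norm_smul, hv1, ht, abs_of_pos hr]; linarith)
    simpa [norm_smul, hv1, abs_of_pos ht0] using this
  have hFsep : ∀ m n, m ≠ n → t * c / 2 ≤ ‖F (ξ + t • v m) - F (ξ + t • v n)‖ := by
    intro m n hmn
    have h1 : t • (fderiv ℝ F ξ (v m) - fderiv ℝ F ξ (v n)) =
      (F (ξ + t • v m) - F (ξ + t • v n)) - (F (ξ + t • v m) - F ξ - t • fderiv ℝ F ξ (v m))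
      + (F (ξ + t • v n) - F ξ - t • fderiv ℝ F ξ (v n)) := by
      rw [smul_sub]; abel
    have h2 := norm_add_le ((F (ξ + t • v m) - F (ξ + t • v n)) -
      (F (ξ + t • v m) - F ξ - t • fderiv ℝ F ξ (v m)))
      (F (ξ + t • v n) - F ξ - t • fderiv ℝ F ξ (v n))
    rw [← h1, norm_smul, Real.norm_of_nonneg ht0.le] at h2
    have h3 := norm_sub_le (F (ξ + t • v m) - F (ξ + t • v n))
      (F (ξ + t • v m) - F ξ - t • fderiv ℝ F ξ (v m))
    have h4 := mul_le_mul_of_nonneg_left (hsep m n hmn) ht0.le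
    linarith [hlin m, hlin n]
  have hcomp := hF_compact.2 (Metric.ball ξ r) Metric.isBounded_ball
  obtain ⟨a, -, φ, hφ, hlim⟩ := hcomp.tendsto_subseq (x := fun n => F (ξ + t • v n)) fun n =>
    subset_closure ⟨_, by simp [norm_smul, hv1, ht, abs_of_pos hr]; linarith, rfl⟩
  obtain ⟨N, hN⟩ := Metric.cauchySeq_iff'.1 hlim.cauchySeq (t * c / 2) (by positivity)
  have h1 := hN (N + 1) (by omega)
  have h2 := hFsep (φ (N + 1)) (φ N) (hφ.injective.ne (by omega))
  rw [dist_eq_norm] at h1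
  exact absurd h1 (not_lt.2 h2)

variable {F : H → H}

theorem exists_lt_forall_Ico_not_hasEigenvalue (hF_compact : IsCompactMap F)
    (hF : Differentiable ℝ F) (ξ : H) {e : ℝ} (he : 0 < e) :
    ∃ d < e, ∀ s ∈ Ioo d e, ¬ Module.End.HasEigenvalue (T F ξ : H →ₗ[ℝ] H) s := by
  have hfin := finite_eigenvalues_ge hF_compact hF ξ (half_pos he)
  have h1 : ∀ᶠ s in 𝓝[<] e,
      s ∉ {s | e / 2 ≤ s ∧ Module.End.HasEigenvalue (T F ξ : H →ₗ[ℝ] H) s} \ {e} :=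
    nhdsWithin_le_nhds ((hfin.subset sdiff_subset).isClosed.isOpen_compl.mem_nhds (by simp))
  have h2 : ∀ᶠ s in 𝓝[<] e, e / 2 < s := nhdsWithin_le_nhds (lt_mem_nhds (half_lt_self he))
  obtain ⟨d, hd, hsub⟩ := (mem_nhdsLT_iff_exists_Ioo_subset' (half_lt_self he)).1 (h1.and h2)
  exact ⟨d, hd, fun s hs hs' => (hsub hs).1 ⟨⟨(hsub hs).2.le, hs'⟩, hs.2.ne⟩⟩

theorem exists_gt_forall_Ioo_not_hasEigenvalue (hF_compact : IsCompactMap F)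
    (hF : Differentiable ℝ F) (ξ : H) {e : ℝ} (he : 0 < e) :
    ∃ d > e, ∀ s ∈ Ioo e d, ¬ Module.End.HasEigenvalue (T F ξ : H →ₗ[ℝ] H) s := by
  have hfin := finite_eigenvalues_ge hF_compact hF ξ he
  have h1 : ∀ᶠ s in 𝓝[>] e,
      s ∉ {s | e ≤ s ∧ Module.End.HasEigenvalue (T F ξ : H →ₗ[ℝ] H) s} \ {e} :=
    nhdsWithin_le_nhds ((hfin.subset sdiff_subset).isClosed.isOpen_compl.mem_nhds (by simp))
  obtain ⟨d, hd, hsub⟩ := (mem_nhdsGT_iff_exists_Ioo_subset' (lt_add_one e)).1 h1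
  exact ⟨d, hd, fun s hs hs' => hsub hs ⟨⟨hs.1.le, hs'⟩, hs.1.ne'⟩⟩

/-- An eigenvalue equal to e does no harm: it lies in both closed intervals, and none lies just
below e. -/
theorem eventually_P_eq_left (hF_compact : IsCompactMap F) (hF : Differentiable ℝ F) (N₁ : ℝ)
    (ξ : H) {e : ℝ} (he : 0 < e) : ∀ᶠ e' in 𝓝[≤] e, P F N₁ ξ e' = P F N₁ ξ e := by
  obtain ⟨d, hd, h⟩ := exists_lt_forall_Ico_not_hasEigenvalue hF_compact hF ξ he
  filter_upwards [nhdsWithin_le_nhds (lt_mem_nhds hd), self_mem_nhdsWithin] with e' h1 h2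
  exact spectralProj_Icc_congr _ h2 fun s hs => h s ⟨h1.trans_le hs.1, hs.2⟩

theorem eventually_P_eq (hF_compact : IsCompactMap F) (hF : Differentiable ℝ F) (N₁ : ℝ)
    (ξ : H) {e : ℝ} (he : 0 < e) (hne : ¬ Module.End.HasEigenvalue (T F ξ : H →ₗ[ℝ] H) e) :
    ∀ᶠ e' in 𝓝 e, P F N₁ ξ e' = P F N₁ ξ e := by
  obtain ⟨d, hd, h⟩ := exists_gt_forall_Ioo_not_hasEigenvalue hF_compact hF ξ he
  have h1 := eventually_nhdsWithin_iff.1 (eventually_P_eq_left hF_compact hF N₁ ξ he)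
  filter_upwards [h1, gt_mem_nhds hd] with e' h1 h2
  rcases le_total e' e with h3 | h3
  · exact h1 h3
  · refine (spectralProj_Icc_congr _ h3 fun s hs => ?_).symm
    rcases hs.1.eq_or_lt with h4 | h4
    · rwa [← h4]
    · exact h s ⟨h4, hs.2.trans h2⟩

end Spectral

end Operators

end GaussNewton

namespace GaussNewton

/-! ### Integral equations with a right-continuous right-hand side. -/

section ODE

variable {E : Type*} [NormedAddCommGroup E] [NormedSpace ℝ E]

-- Sampling at the next point strictly to the right on the grid of mesh 1/(n+1) gives measurable
-- functions of ⌊(n+1)t⌋; right-continuity yields pointwise convergence.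
omit [NormedSpace ℝ E] in
theorem stronglyMeasurable_of_continuousWithinAt_Ici {f : ℝ → E}
    (hf : ∀ t, ContinuousWithinAt f (Ici t) t) : StronglyMeasurable f := by
  refine stronglyMeasurable_of_tendsto (u := atTop)
    (f := fun (n : ℕ) t => f ((⌊((n : ℝ) + 1) * t⌋ + 1 : ℝ) / (n + 1))) (fun n => ?_) ?_
  · exact (StronglyMeasurable.of_discrete
      (f := fun k : ℤ => f (((k : ℝ) + 1) / ((n : ℝ) + 1)))).comp_measurable
      (Int.measurable_floor.comp (measurable_const.mul measurable_id))
  · refine tendsto_pi_nhds.2 fun t => (hf t).tendsto.comp (tendsto_nhdsWithin_iff.2 ⟨?_, ?_⟩)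
    · have h1 : Tendsto (fun n : ℕ => t + 1 / ((n : ℝ) + 1)) atTop (𝓝 t) := by
        simpa using tendsto_one_div_add_atTop_nhds_zero_nat.const_add t
      refine tendsto_of_tendsto_of_tendsto_of_le_of_le tendsto_const_nhds h1 (fun n => ?_)
        (fun n => ?_)
      · have := Int.lt_floor_add_one (((n : ℝ) + 1) * t)
        rw [le_div_iff₀ (by positivity)]; linarith
      · have := Int.floor_le (((n : ℝ) + 1) * t)
        change _ / _ ≤ _
        have h2 : (t + 1 / ((n : ℝ) + 1)) * ((n : ℝ) + 1) = ((n : ℝ) + 1) * t + 1 := by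
          field_simp
        rw [div_le_iff₀ (by positivity), h2]
        linarith
    · refine Eventually.of_forall fun n => ?_
      have := Int.lt_floor_add_one (((n : ℝ) + 1) * t)
      change t ≤ ((⌊((n : ℝ) + 1) * t⌋ : ℝ) + 1) / ((n : ℝ) + 1)
      rw [le_div_iff₀ (by positivity)]; linarith

omit [NormedSpace ℝ E] in
theorem exists_stronglyMeasurable_eqOn_Ici {f : ℝ → E}
    (hf : ∀ t, 0 ≤ t → ContinuousWithinAt f (Ici t) t) :
    ∃ g : ℝ → E, StronglyMeasurable g ∧ EqOn f g (Ici 0) := by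
  refine ⟨fun t => f (max t 0), stronglyMeasurable_of_continuousWithinAt_Ici fun t => ?_,
    fun t ht => by simp [max_eq_left (mem_Ici.1 ht)]⟩
  have hc : ContinuousWithinAt (fun t : ℝ => max t 0) (Ici t) t := by fun_prop
  exact (hf (max t 0) (le_max_right _ _)).comp (f := fun t : ℝ => max t 0) hc
    fun s hs => mem_Ici.2 (max_le_max_right 0 (mem_Ici.1 hs))

omit [NormedSpace ℝ E] in
theorem aestronglyMeasurable_uIoc {f : ℝ → E}
    (hf : ∀ t, 0 ≤ t → ContinuousWithinAt f (Ici t) t) {t : ℝ} (ht : 0 ≤ t) :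
    AEStronglyMeasurable f (volume.restrict (uIoc 0 t)) := by
  obtain ⟨g, hg, hfg⟩ := exists_stronglyMeasurable_eqOn_Ici hf
  refine ⟨g, hg, ?_⟩
  filter_upwards [ae_restrict_mem measurableSet_uIoc] with s hs
  rw [uIoc_of_le ht] at hs
  exact hfg hs.1.le

theorem intervalIntegrable_of_norm_le {f : ℝ → E}
    (hf : ∀ t, 0 ≤ t → ContinuousWithinAt f (Ici t) t) {t M : ℝ} (ht : 0 ≤ t)
    (hM : ∀ s ∈ Icc 0 t, ‖f s‖ ≤ M) : IntervalIntegrable f volume 0 t := by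
  refine (intervalIntegrable_const (c := M)).mono_fun' (aestronglyMeasurable_uIoc hf ht) ?_
  filter_upwards [ae_restrict_mem measurableSet_uIoc] with s hs
  rw [uIoc_of_le ht] at hs
  exact hM s ⟨hs.1.le, hs.2⟩

variable [CompleteSpace E]


omit [CompleteSpace E] in
theorem continuousOn_primitive_Ici {f : ℝ → E}
    (hf : ∀ t, 0 ≤ t → IntervalIntegrable f volume 0 t) (z₀ : E) :
    ContinuousOn (fun t => z₀ + ∫ s in (0 : ℝ)..t, f s) (Ici 0) := by
  refine continuousOn_const.add fun t ht => ?_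
  have h1 : (0 : ℝ) ≤ t + 1 := by linarith [mem_Ici.1 ht]
  have := intervalIntegral.continuousOn_primitive_interval'
    (hf (t + 1) h1) left_mem_uIcc
  rw [uIcc_of_le h1] at this
  refine (this t ⟨ht, by linarith⟩).mono_of_mem_nhdsWithin ?_
  filter_upwards [self_mem_nhdsWithin, nhdsWithin_le_nhds (gt_mem_nhds (lt_add_one t))] with s a b
  exact ⟨a, b.le⟩

/-- Picard iteration for a right-hand side which is merely right-continuous in time, and
Lipschitz and bounded in space, locally uniformly in time. -/
theorem exists_integral_solution {G : E → ℝ → E} (z₀ : E)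
    (hrc : ∀ u : ℝ → E, ContinuousOn u (Ici 0) → ∀ t, 0 ≤ t →
      ContinuousWithinAt (fun s => G (u s) s) (Ici t) t)
    (hlip : ∀ b, 0 ≤ b → ∃ L, 0 ≤ L ∧ ∀ t ∈ Icc 0 b, ∀ x y, ‖G x t - G y t‖ ≤ L * ‖x - y‖)
    (hbd : ∀ b, 0 ≤ b → ∃ M, 0 ≤ M ∧ ∀ t ∈ Icc 0 b, ∀ x, ‖G x t‖ ≤ M) :
    ∃ z : ℝ → E, ContinuousOn z (Ici 0) ∧
      ∀ t, 0 ≤ t → z t = z₀ + ∫ s in (0 : ℝ)..t, G (z s) s := by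
  have hint : ∀ u : ℝ → E, ContinuousOn u (Ici 0) → ∀ t, 0 ≤ t →
      IntervalIntegrable (fun s => G (u s) s) volume 0 t := fun u hu t ht => by
    obtain ⟨M, -, hM⟩ := hbd t ht
    exact intervalIntegrable_of_norm_le (hrc u hu) ht fun s hs => hM s hs _
  let Γ : (ℝ → E) → ℝ → E := fun u t => z₀ + ∫ s in (0 : ℝ)..t, G (u s) s
  let U : ℕ → ℝ → E := fun n => Γ^[n] fun _ => z₀
  have hU1 : ∀ n t, U (n + 1) t = z₀ + ∫ s in (0 : ℝ)..t, G (U n s) s := fun n t => by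
    simp only [U, Function.iterate_succ_apply', Γ]
  have hUc : ∀ n, ContinuousOn (U n) (Ici 0) := by
    intro n
    induction n with
    | zero => exact continuousOn_const
    | succ n ih =>
      exact (continuousOn_primitive_Ici (hint _ ih) z₀).congr fun t _ => hU1 n t
  have hdiff : ∀ b, 0 ≤ b → ∃ a : ℕ → ℝ, Summable a ∧
      ∀ n, ∀ t ∈ Icc 0 b, ‖U (n + 1) t - U n t‖ ≤ a n := by
    intro b hb
    obtain ⟨M, hM0, hM⟩ := hbd b hb
    obtain ⟨L, hL0, hL⟩ := hlip b hb
    -- Each integration supplies a new factor Lt/(n+2), so the increments are dominated by an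
    -- exponential series and no smallness of b is needed.
    have hest : ∀ n, ∀ t ∈ Icc 0 b,
        ‖U (n + 1) t - U n t‖ ≤ M * L ^ n * t ^ (n + 1) / (n + 1).factorial := by
      intro n
      induction n with
      | zero =>
        intro t ht
        have : U (0 + 1) t - U 0 t = ∫ s in (0 : ℝ)..t, G (U 0 s) s := by
          rw [hU1]; simp [U]
        rw [this]
        have := intervalIntegral.norm_integral_le_of_norm_le_const (a := 0) (b := t)
          (f := fun s => G (U 0 s) s) (C := M) fun s hs => by
            rw [uIoc_of_le ht.1] at hs
            exact hM s ⟨hs.1.le, hs.2.trans ht.2⟩ _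
        simpa [abs_of_nonneg ht.1] using this
      | succ n ih =>
        intro t ht
        have h1 : U (n + 1 + 1) t - U (n + 1) t =
            ∫ s in (0 : ℝ)..t, (G (U (n + 1) s) s - G (U n s) s) := by
          rw [intervalIntegral.integral_sub (hint _ (hUc _) t ht.1) (hint _ (hUc _) t ht.1),
            hU1 (n + 1), hU1 n]
          abel
        rw [h1]
        have h2 := intervalIntegral.norm_integral_le_of_norm_le (μ := volume) ht.1
          (f := fun s => G (U (n + 1) s) s - G (U n s) s)
          (g := fun s => L * (M * L ^ n * s ^ (n + 1) / (n + 1).factorial))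
          (Eventually.of_forall fun s hs => by
            have hs' : s ∈ Icc 0 b := ⟨hs.1.le, hs.2.trans ht.2⟩
            exact (hL s hs' _ _).trans (mul_le_mul_of_nonneg_left (ih s hs') hL0))
          (Continuous.intervalIntegrable (by fun_prop) _ _)
        refine h2.trans (le_of_eq ?_)
        rw [intervalIntegral.integral_const_mul, intervalIntegral.integral_div,
          intervalIntegral.integral_const_mul, integral_pow, Nat.factorial_succ (n + 1)]
        have : ((n + 1).factorial : ℝ) ≠ 0 := by positivity
        push_cast
        field_simp
        simp
        try ring
    refine ⟨fun n => M * b * ((L * b) ^ n / n.factorial), ?_, fun n t ht => (hest n t ht).trans ?_⟩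
    · exact (Real.summable_pow_div_factorial (L * b)).mul_left _
    · have h1 : t ^ (n + 1) ≤ b ^ (n + 1) := pow_le_pow_left₀ ht.1 ht.2 _
      have h2 : (n.factorial : ℝ) ≤ (n + 1).factorial := by
        exact_mod_cast Nat.factorial_le (Nat.le_succ n)
      have h3 : (0 : ℝ) < n.factorial := by positivity
      calc M * L ^ n * t ^ (n + 1) / (n + 1).factorial
          ≤ M * L ^ n * b ^ (n + 1) / n.factorial := by gcongr
        _ = _ := by ring
  let z : ℝ → E := fun t => z₀ + ∑' n, (U (n + 1) t - U n t)
  have hunif : ∀ b, 0 ≤ b → TendstoUniformlyOn U z atTop (Icc 0 b) := by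
    intro b hb
    obtain ⟨a, ha, hab⟩ := hdiff b hb
    have h1 := tendstoUniformlyOn_tsum_nat ha hab
    have h2 : ∀ N t, U N t = z₀ + ∑ n ∈ Finset.range N, (U (n + 1) t - U n t) := fun N t => by
      rw [Finset.sum_range_sub (fun n => U n t)]; simp [U]
    rw [Metric.tendstoUniformlyOn_iff] at h1 ⊢
    intro δ hδ
    filter_upwards [h1 δ hδ] with N hN t ht
    rw [h2 N t, dist_add_left]
    exact hN t ht
  have hzc : ContinuousOn z (Ici 0) := fun t ht => by
    have hb : (0 : ℝ) ≤ t + 1 := by linarith [mem_Ici.1 ht]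
    have := (hunif (t + 1) hb).continuousOn
      (Frequently.of_forall fun n => (hUc n).mono Icc_subset_Ici_self)
    refine (this t ⟨ht, by linarith⟩).mono_of_mem_nhdsWithin ?_
    filter_upwards [self_mem_nhdsWithin, nhdsWithin_le_nhds (gt_mem_nhds (lt_add_one t))] with s a b
    exact ⟨a, b.le⟩
  refine ⟨z, hzc, fun t ht => ?_⟩
  have hlim : ∀ s ∈ Icc 0 t, Tendsto (fun n => U n s) atTop (𝓝 (z s)) :=
    fun s hs => (hunif t ht).tendsto_at hs
  obtain ⟨M, -, hM⟩ := hbd t ht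
  obtain ⟨L, -, hL⟩ := hlip t ht
  have h1 : Tendsto (fun n => ∫ s in (0 : ℝ)..t, G (U n s) s) atTop
      (𝓝 (∫ s in (0 : ℝ)..t, G (z s) s)) := by
    refine intervalIntegral.tendsto_integral_filter_of_dominated_convergence (fun _ => M)
      (Eventually.of_forall fun n => aestronglyMeasurable_uIoc (hrc _ (hUc n)) ht)
      (Eventually.of_forall fun n => Eventually.of_forall fun s hs => ?_)
      intervalIntegrable_const (Eventually.of_forall fun s hs => ?_)
    · rw [uIoc_of_le ht] at hs
      exact hM s ⟨hs.1.le, hs.2⟩ _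
    · rw [uIoc_of_le ht] at hs
      have hs' : s ∈ Icc 0 t := ⟨hs.1.le, hs.2⟩
      rw [tendsto_iff_norm_sub_tendsto_zero]
      refine squeeze_zero (fun _ => norm_nonneg _) (fun n => hL s hs' _ _) ?_
      simpa using (tendsto_iff_norm_sub_tendsto_zero.1 (hlim s hs')).const_mul L
  have h2 : Tendsto (fun n => U (n + 1) t) atTop (𝓝 (z t)) :=
    (hlim t ⟨ht, le_rfl⟩).comp (tendsto_add_atTop_nat 1)
  refine tendsto_nhds_unique h2 ?_
  simp only [hU1]
  exact h1.const_add z₀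

theorem hasDerivWithinAt_Ici_of_eq_integral {z f : ℝ → E} {z₀ : E}
    (hz : ∀ t, 0 ≤ t → z t = z₀ + ∫ s in (0 : ℝ)..t, f s)
    (hint : ∀ t, 0 ≤ t → IntervalIntegrable f volume 0 t)
    (hf : ∀ t, 0 ≤ t → ContinuousWithinAt f (Ici t) t) {t : ℝ} (ht : 0 ≤ t) :
    HasDerivWithinAt z (f t) (Ici t) t := by
  obtain ⟨g, hg, hfg⟩ := exists_stronglyMeasurable_eqOn_Ici hf
  have h1 : HasDerivWithinAt (fun u => ∫ s in (0 : ℝ)..u, f s) (f t) (Ici t) t := by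
    refine intervalIntegral.integral_hasDerivWithinAt_right (hint t ht) (s := Ici t) (t := Ioi t)
      ⟨Ioi t, self_mem_nhdsWithin, g, hg, ?_⟩ ((hf t ht).mono Ioi_subset_Ici_self)
    filter_upwards [ae_restrict_mem measurableSet_Ioi] with s hs
    exact hfg (ht.trans (mem_Ioi.1 hs).le)
  exact (h1.const_add z₀).congr (fun s hs => hz s (ht.trans hs)) (hz t ht)

theorem hasDerivAt_of_eq_integral {z f : ℝ → E} {z₀ : E}
    (hz : ∀ t, 0 ≤ t → z t = z₀ + ∫ s in (0 : ℝ)..t, f s)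
    (hint : ∀ t, 0 ≤ t → IntervalIntegrable f volume 0 t)
    (hf : ∀ t, 0 ≤ t → ContinuousWithinAt f (Ici t) t) {t : ℝ} (ht : 0 < t)
    (hft : ContinuousAt f t) : HasDerivAt z (f t) t := by
  obtain ⟨g, hg, hfg⟩ := exists_stronglyMeasurable_eqOn_Ici hf
  have h1 : HasDerivAt (fun u => ∫ s in (0 : ℝ)..u, f s) (f t) t := by
    refine intervalIntegral.integral_hasDerivAt_right (hint t ht.le)
      ⟨Ioi 0, Ioi_mem_nhds ht, g, hg, ?_⟩ hft
    filter_upwards [ae_restrict_mem measurableSet_Ioi] with s hs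
    exact hfg (mem_Ioi.1 hs).le
  refine (h1.const_add z₀).congr_of_eventuallyEq ?_
  filter_upwards [lt_mem_nhds ht] with s hs using hz s hs.le

end ODE

/-! ### Truncation to a ball. -/

section Retraction

variable {E : Type*} [NormedAddCommGroup E] [NormedSpace ℝ E]

/-- The radial retraction onto the closed ball of centre `y` and radius `R > 0`. -/
noncomputable def radialRetraction (y : E) (R : ℝ) (x : E) : E :=
  y + (R / max R ‖x - y‖) • (x - y)

theorem norm_radialRetraction_sub_le (y : E) {R : ℝ} (hR : 0 < R) (x : E) :
    ‖radialRetraction y R x - y‖ ≤ R := by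
  have hm : 0 < max R ‖x - y‖ := lt_max_of_lt_left hR
  rw [radialRetraction, add_sub_cancel_left, norm_smul, Real.norm_of_nonneg (by positivity),
    div_mul_eq_mul_div, div_le_iff₀ hm]
  exact mul_le_mul_of_nonneg_left (le_max_right _ _) hR.le

theorem radialRetraction_eq_self (y : E) {R : ℝ} (hR : 0 < R) {x : E} (hx : ‖x - y‖ ≤ R) :
    radialRetraction y R x = x := by
  rw [radialRetraction, max_eq_left hx, div_self hR.ne', one_smul, add_sub_cancel]

/-- The vector and the scaling factor contribute one ‖x − x'‖ each: max(R, ‖· − y‖) is 1-Lipschitz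
and bounds ‖x' − y‖. -/
theorem norm_radialRetraction_sub_radialRetraction_le (y : E) {R : ℝ} (hR : 0 < R) (x x' : E) :
    ‖radialRetraction y R x - radialRetraction y R x'‖ ≤ 2 * ‖x - x'‖ := by
  set m := max R ‖x - y‖ with hm
  set m' := max R ‖x' - y‖ with hm'
  have hm0 : 0 < m := lt_max_of_lt_left hR
  have hm0' : 0 < m' := lt_max_of_lt_left hR
  have h1 : radialRetraction y R x - radialRetraction y R x' =
      (R / m) • (x - x') + (R / m * ((m' - m) / m')) • (x' - y) := by
    have : R / m * ((m' - m) / m') = R / m - R / m' := by field_simp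
    rw [this, radialRetraction, radialRetraction, ← hm, ← hm']
    module
  have hRm : R / m ≤ 1 := (div_le_one hm0).2 (le_max_left _ _)
  have h2 : |m' - m| ≤ ‖x - x'‖ := by
    have h3 : |m' - m| ≤ |‖x' - y‖ - ‖x - y‖| := by
      rw [hm, hm', max_comm R, max_comm R]; exact abs_max_sub_max_le_abs _ _ _
    refine h3.trans ((abs_norm_sub_norm_le _ _).trans_eq ?_)
    rw [sub_sub_sub_cancel_right, norm_sub_rev]
  rw [h1]
  calc _ ≤ ‖(R / m) • (x - x')‖ + ‖(R / m * ((m' - m) / m')) • (x' - y)‖ := norm_add_le _ _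
    _ = R / m * ‖x - x'‖ + R / m * (|m' - m| * (‖x' - y‖ / m')) := by
      rw [norm_smul, norm_smul, Real.norm_of_nonneg (by positivity), norm_mul,
        Real.norm_of_nonneg (show 0 ≤ R / m by positivity), Real.norm_eq_abs, abs_div,
        abs_of_pos hm0']
      ring
    _ ≤ 1 * ‖x - x'‖ + 1 * (‖x - x'‖ * 1) := by
      have h4 : ‖x' - y‖ / m' ≤ 1 := (div_le_one hm0').2 (le_max_right _ _)
      gcongr
    _ = _ := by ring

theorem continuous_radialRetraction (y : E) {R : ℝ} (hR : 0 < R) :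
    Continuous (radialRetraction y R) := by
  have : LipschitzWith 2 (radialRetraction y R) := LipschitzWith.of_dist_le_mul fun x x' => by
    simpa [dist_eq_norm] using norm_radialRetraction_sub_radialRetraction_le y hR x x'
  exact this.continuous

end Retraction

end GaussNewton

namespace GaussNewton

/-! ### Estimates for the field `Phi` and the barrier argument. -/

section Dynamics

variable {H : Type*} [NormedAddCommGroup H] [InnerProductSpace ℝ H] [CompleteSpace H]
  {F : H → H} {N₁ N₂ : ℝ}

local notation "⟪" x ", " y "⟫" => inner ℝ x y

theorem norm_P_apply_le (F : H → H) (N₁ : ℝ) (ξ : H) (e : ℝ) (x : H) : ‖P F N₁ ξ e x‖ ≤ ‖x‖ :=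
  norm_spectralProj_apply_le _ _ _

theorem norm_P_sub_one_apply_le (F : H → H) (N₁ : ℝ) (ξ : H) (e : ℝ) (x : H) :
    ‖(P F N₁ ξ e - 1) x‖ ≤ ‖x‖ :=
  norm_spectralProj_sub_one_apply_le _ _ _

theorem norm_smul_P_TepsInv_apply_le (hN₁ : ∀ x, ‖fderiv ℝ F x‖ ≤ N₁)
    (hF' : Differentiable ℝ (fderiv ℝ F)) (hN₂ : ∀ x, ‖fderiv ℝ (fderiv ℝ F) x‖ ≤ N₂)
    (ξ y h : H) {e C : ℝ} (he : 0 < e)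
    (hC : ‖P F N₁ ξ e ∘L TepsInv F e ξ ∘L (T F y - T F ξ)‖ ≤ C) (x : H) :
    ‖e • P F N₁ ξ e (TepsInv F e h x)‖ ≤ (1 / 2 + C + N₁ * N₂ / e * ‖h - y‖) * ‖x‖ := by
  set A := P F N₁ ξ e
  set s := TepsInv F e h x with hs
  have hsn : ‖s‖ ≤ e⁻¹ * ‖x‖ := norm_TepsInv_apply_le F he h x
  have hC0 : 0 ≤ C := (norm_nonneg _).trans hC
  -- Resolvent identity between h and ξ, with T(ξ) − T(h) split through T(y) so that the smallness
  -- constant C applies.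
  have hdec : s = TepsInv F e ξ x - TepsInv F e ξ ((T F y - T F ξ) s)
      + TepsInv F e ξ ((T F y - T F h) s) := by
    have h1 := congrArg (fun B : H →L[ℝ] H => B x) (TepsInv_sub_TepsInv F he h ξ)
    have h2 : s - TepsInv F e ξ x = TepsInv F e ξ ((T F ξ - T F h) s) := h1
    have h3 : (T F ξ - T F h) s = (T F y - T F h) s - (T F y - T F ξ) s := by
      simp only [sub_apply]; abel
    rw [h3, map_sub] at h2
    refine (eq_add_of_sub_eq' h2).trans ?_
    abel
  have h1 : ‖A (TepsInv F e ξ x)‖ ≤ (2 * e)⁻¹ * ‖x‖ := norm_P_TepsInv_apply_le F N₁ ξ he x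
  have h2 : ‖A (TepsInv F e ξ ((T F y - T F ξ) s))‖ ≤ C * (e⁻¹ * ‖x‖) :=
    ((A ∘L TepsInv F e ξ ∘L (T F y - T F ξ)).le_opNorm s).trans (by gcongr)
  have h3 : ‖A (TepsInv F e ξ ((T F y - T F h) s))‖ ≤
      (2 * e)⁻¹ * (2 * N₁ * N₂ * ‖h - y‖ * (e⁻¹ * ‖x‖)) := by
    refine (norm_P_TepsInv_apply_le F N₁ ξ he _).trans ?_
    have hT := norm_T_sub_le hN₁ hF' hN₂ y h
    rw [norm_sub_rev y h] at hT
    have := (T F y - T F h).le_of_opNorm_le hT s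
    have h0 := (norm_nonneg _).trans hT
    gcongr
    exact this.trans (by gcongr)
  have h4 : ‖A s‖ ≤ (2 * e)⁻¹ * ‖x‖ + C * (e⁻¹ * ‖x‖)
      + (2 * e)⁻¹ * (2 * N₁ * N₂ * ‖h - y‖ * (e⁻¹ * ‖x‖)) := by
    rw [hdec, map_add, map_sub]
    exact (norm_add_le _ _).trans (add_le_add ((norm_sub_le _ _).trans (add_le_add h1 h2)) h3)
  rw [norm_smul, Real.norm_of_nonneg he.le]
  refine (mul_le_mul_of_nonneg_left h4 he.le).trans (le_of_eq ?_)
  field_simp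

theorem inner_sub_field_le (hF : Differentiable ℝ F) (hN₁ : ∀ x, ‖fderiv ℝ F x‖ ≤ N₁)
    (hF' : Differentiable ℝ (fderiv ℝ F)) (hN₂ : ∀ x, ‖fderiv ℝ (fderiv ℝ F) x‖ ≤ N₂)
    {y : H} (hy : F y = 0) (ξ z₀ h : H) {e C : ℝ} (he : 0 < e)
    (hC : ‖P F N₁ ξ e ∘L TepsInv F e ξ ∘L (T F y - T F ξ)‖ ≤ C) :
    ⟪h - y, (P F N₁ ξ e - 1) (h - z₀)
      - P F N₁ ξ e (TepsInv F e h (ContinuousLinearMap.adjoint (fderiv ℝ F h) (F h)))⟫ ≤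
    ‖h - y‖ * (‖(P F N₁ ξ e - 1) (y - z₀)‖ - (1 / 2 - C) * ‖h - y‖
      + (4 * N₁ * N₂ + N₂ * √e) / (4 * e) * ‖h - y‖ ^ 2) := by
  set w := h - y with hw
  set A := P F N₁ ξ e with hA
  set K := F h - F y - fderiv ℝ F h w with hK
  have hFh : ContinuousLinearMap.adjoint (fderiv ℝ F h) (F h) =
      T F h w + ContinuousLinearMap.adjoint (fderiv ℝ F h) K := by
    rw [hK, hy]; simp [T]
  have hdec : (A - 1) (h - z₀)
      - A (TepsInv F e h (ContinuousLinearMap.adjoint (fderiv ℝ F h) (F h))) =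
      -w + ((A - 1) (y - z₀) + e • A (TepsInv F e h w)
        - A (TepsInv F e h (ContinuousLinearMap.adjoint (fderiv ℝ F h) K))) := by
    rw [hFh, map_add, TepsInv_T_apply F he, show h - z₀ = w + (y - z₀) by rw [hw]; abel]
    simp only [map_add, map_sub, map_smul, sub_apply, one_apply_eq_self]
    abel
  have h1 := norm_smul_P_TepsInv_apply_le hN₁ hF' hN₂ ξ y h he hC w
  have hKn : ‖K‖ ≤ N₂ / 2 * ‖w‖ ^ 2 := norm_remainder_le hF hF' hN₂ h y
  have hse : 0 < √e := Real.sqrt_pos.2 he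
  have h2 : ‖A (TepsInv F e h (ContinuousLinearMap.adjoint (fderiv ℝ F h) K))‖ ≤
      N₂ / 2 * ‖w‖ ^ 2 / (2 * √e) :=
    (norm_P_apply_le F N₁ ξ e _).trans
      ((norm_TepsInv_adjoint_apply_le F he h K).trans (by gcongr))
  have h3 : N₂ / 2 * ‖w‖ ^ 2 / (2 * √e) = N₂ * √e / (4 * e) * ‖w‖ ^ 2 := by
    rw [div_mul_eq_mul_div (N₂ * √e), div_eq_div_iff (by positivity) (by positivity)]
    linear_combination (-2 * N₂ * ‖w‖ ^ 2) * Real.mul_self_sqrt he.le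
  rw [hdec, inner_add_right, inner_neg_right, real_inner_self_eq_norm_sq]
  have h4 := (real_inner_le_norm w ((A - 1) (y - z₀) + e • A (TepsInv F e h w)
        - A (TepsInv F e h (ContinuousLinearMap.adjoint (fderiv ℝ F h) K)))).trans
    (mul_le_mul_of_nonneg_left ((norm_sub_le _ _).trans
      (add_le_add ((norm_add_le _ _).trans (add_le_add le_rfl h1)) (h2.trans_eq h3)))
      (norm_nonneg w))
  refine (add_le_add le_rfl h4).trans (le_of_eq ?_)
  field_simp
  ring

omit [CompleteSpace H] in
theorem norm_apply_le_of_zero (hF : Differentiable ℝ F) (hN₁ : ∀ x, ‖fderiv ℝ F x‖ ≤ N₁)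
    {y : H} (hy : F y = 0) (h : H) : ‖F h‖ ≤ N₁ * ‖h - y‖ := by
  have := convex_univ.norm_image_sub_le_of_norm_fderiv_le (𝕜 := ℝ) (fun x _ => hF x)
    (fun x _ => hN₁ x) (mem_univ y) (mem_univ h)
  rwa [hy, sub_zero] at this

theorem norm_field_le (hF : Differentiable ℝ F) (hN₁ : ∀ x, ‖fderiv ℝ F x‖ ≤ N₁)
    {y : H} (hy : F y = 0) (ξ z₀ : H) {d e R : ℝ} (hd : 0 < d) (hde : d ≤ e) {h : H}
    (hh : ‖h - y‖ ≤ R) :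
    ‖(P F N₁ ξ e - 1) (h - z₀)
      - P F N₁ ξ e (TepsInv F e h (ContinuousLinearMap.adjoint (fderiv ℝ F h) (F h)))‖ ≤
    R + ‖y - z₀‖ + d⁻¹ * (N₁ * (N₁ * R)) := by
  have hN0 : 0 ≤ N₁ := (norm_nonneg _).trans (hN₁ h)
  have hR0 : 0 ≤ R := (norm_nonneg _).trans hh
  have he := hd.trans_le hde
  have h1 : ‖(P F N₁ ξ e - 1) (h - z₀)‖ ≤ R + ‖y - z₀‖ := by
    refine (norm_P_sub_one_apply_le F N₁ ξ e _).trans ?_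
    rw [← sub_add_sub_cancel h y z₀]
    exact (norm_add_le _ _).trans (by gcongr)
  have h2 : ‖ContinuousLinearMap.adjoint (fderiv ℝ F h) (F h)‖ ≤ N₁ * (N₁ * R) := by
    refine (ContinuousLinearMap.le_opNorm _ _).trans ?_
    rw [LinearIsometryEquiv.norm_map]
    exact mul_le_mul (hN₁ h) ((norm_apply_le_of_zero hF hN₁ hy h).trans (by gcongr))
      (norm_nonneg _) hN0
  refine (norm_sub_le _ _).trans (add_le_add h1 ((norm_P_apply_le F N₁ ξ e _).trans
    ((norm_TepsInv_apply_le F he h _).trans ?_)))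
  gcongr

/-- Uniformity in e ≥ d comes from ‖T_e⁻¹‖ ≤ 1/d; on [0, b] it is used with d = ε(b). -/
theorem exists_lipschitz_field (hF : Differentiable ℝ F) (hN₁ : ∀ x, ‖fderiv ℝ F x‖ ≤ N₁)
    (hF' : Differentiable ℝ (fderiv ℝ F)) (hN₂ : ∀ x, ‖fderiv ℝ (fderiv ℝ F) x‖ ≤ N₂)
    {y : H} (hy : F y = 0) (ξ z₀ : H) {d R : ℝ} (hd : 0 < d) (hR : 0 ≤ R) :
    ∃ L, 0 ≤ L ∧ ∀ e, d ≤ e → ∀ h h' : H, ‖h - y‖ ≤ R → ‖h' - y‖ ≤ R →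
    ‖((P F N₁ ξ e - 1) (h - z₀)
      - P F N₁ ξ e (TepsInv F e h (ContinuousLinearMap.adjoint (fderiv ℝ F h) (F h))))
    - ((P F N₁ ξ e - 1) (h' - z₀)
      - P F N₁ ξ e (TepsInv F e h' (ContinuousLinearMap.adjoint (fderiv ℝ F h') (F h'))))‖ ≤
    L * ‖h - h'‖ := by
  have hN0 : 0 ≤ N₁ := (norm_nonneg _).trans (hN₁ y)
  have hN20 : 0 ≤ N₂ := (norm_nonneg (fderiv ℝ (fderiv ℝ F) y)).trans (hN₂ y)
  refine ⟨1 + (d⁻¹ * (2 * N₁ * N₂ * (d⁻¹ * (N₁ * (N₁ * R)))) + d⁻¹ * (N₂ * (N₁ * R) + N₁ * N₁)),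
    by positivity, fun e hde h h' hh hh' => ?_⟩
  have he := hd.trans_le hde
  have hei : e⁻¹ ≤ d⁻¹ := inv_anti₀ hd hde
  set a : H → H := fun h => ContinuousLinearMap.adjoint (fderiv ℝ F h) (F h) with ha
  have ha1 : ‖a h‖ ≤ N₁ * (N₁ * R) := by
    refine (ContinuousLinearMap.le_opNorm _ _).trans ?_
    rw [LinearIsometryEquiv.norm_map]
    exact mul_le_mul (hN₁ h) ((norm_apply_le_of_zero hF hN₁ hy h).trans (by gcongr))
      (norm_nonneg _) hN0
  have ha2 : ‖a h - a h'‖ ≤ (N₂ * (N₁ * R) + N₁ * N₁) * ‖h - h'‖ := by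
    have e1 : a h - a h' = ContinuousLinearMap.adjoint (fderiv ℝ F h - fderiv ℝ F h') (F h)
        + ContinuousLinearMap.adjoint (fderiv ℝ F h') (F h - F h') := by
      simp [ha]
    have h1 : ‖ContinuousLinearMap.adjoint (fderiv ℝ F h - fderiv ℝ F h') (F h)‖ ≤
        (N₂ * ‖h - h'‖) * (N₁ * R) := by
      refine (ContinuousLinearMap.le_opNorm _ _).trans ?_
      rw [LinearIsometryEquiv.norm_map]
      exact mul_le_mul (norm_fderiv_sub_le hF' hN₂ h h')
        ((norm_apply_le_of_zero hF hN₁ hy h).trans (by gcongr)) (norm_nonneg _) (by positivity)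
    have h2 : ‖ContinuousLinearMap.adjoint (fderiv ℝ F h') (F h - F h')‖ ≤
        N₁ * (N₁ * ‖h - h'‖) := by
      refine (ContinuousLinearMap.le_opNorm _ _).trans ?_
      rw [LinearIsometryEquiv.norm_map]
      exact mul_le_mul (hN₁ h') (convex_univ.norm_image_sub_le_of_norm_fderiv_le (𝕜 := ℝ)
        (fun x _ => hF x) (fun x _ => hN₁ x) (mem_univ h') (mem_univ h)) (norm_nonneg _) hN0
    rw [e1]
    exact (norm_add_le _ _).trans ((add_le_add h1 h2).trans_eq (by ring))
  have hS : TepsInv F e h (a h) - TepsInv F e h' (a h') =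
      TepsInv F e h' ((T F h' - T F h) (TepsInv F e h (a h))) + TepsInv F e h' (a h - a h') := by
    have h1 := congrArg (fun B : H →L[ℝ] H => B (a h)) (TepsInv_sub_TepsInv F he h h')
    have h2 : TepsInv F e h (a h) - TepsInv F e h' (a h) =
      TepsInv F e h' ((T F h' - T F h) (TepsInv F e h (a h))) := h1
    rw [← h2, map_sub]; abel
  have hS1 : ‖TepsInv F e h' ((T F h' - T F h) (TepsInv F e h (a h)))‖ ≤
      d⁻¹ * ((2 * N₁ * N₂ * ‖h - h'‖) * (d⁻¹ * (N₁ * (N₁ * R)))) := by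
    refine (norm_TepsInv_apply_le F he h' _).trans ?_
    have hT := norm_T_sub_le hN₁ hF' hN₂ h' h
    rw [norm_sub_rev h' h] at hT
    have h1 : ‖TepsInv F e h (a h)‖ ≤ d⁻¹ * (N₁ * (N₁ * R)) :=
      (norm_TepsInv_apply_le F he h _).trans (by gcongr)
    have h2 := ((T F h' - T F h).le_of_opNorm_le hT (TepsInv F e h (a h))).trans
      (mul_le_mul_of_nonneg_left h1 (by positivity))
    gcongr
  have hS2 : ‖TepsInv F e h' (a h - a h')‖ ≤
      d⁻¹ * ((N₂ * (N₁ * R) + N₁ * N₁) * ‖h - h'‖) :=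
    (norm_TepsInv_apply_le F he h' _).trans (by gcongr)
  have e2 : ((P F N₁ ξ e - 1) (h - z₀) - P F N₁ ξ e (TepsInv F e h (a h)))
      - ((P F N₁ ξ e - 1) (h' - z₀) - P F N₁ ξ e (TepsInv F e h' (a h'))) =
      (P F N₁ ξ e - 1) (h - h')
        - P F N₁ ξ e (TepsInv F e h (a h) - TepsInv F e h' (a h')) := by
    rw [← sub_sub_sub_cancel_right h h' z₀, map_sub (P F N₁ ξ e - 1) (h - z₀), map_sub (P F N₁ ξ e)]
    abel
  rw [e2]
  have h5 := (norm_P_apply_le F N₁ ξ e (TepsInv F e h (a h) - TepsInv F e h' (a h')))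
  rw [hS] at h5 ⊢
  refine (norm_sub_le _ _).trans ((add_le_add (norm_P_sub_one_apply_le F N₁ ξ e (h - h'))
    (h5.trans ((norm_add_le _ _).trans (add_le_add hS1 hS2)))).trans_eq (by ring))

/-- Everything but the projection is jointly continuous, so it suffices to freeze `P` near t. -/
theorem continuousWithinAt_Phi (hF : Differentiable ℝ F) (hF' : Differentiable ℝ (fderiv ℝ F))
    {ε : ℝ → ℝ} {w : ℝ → H} {S : Set ℝ} {t : ℝ} (ξ z₀ : H) (hε : ContinuousWithinAt ε S t)
    (hw : ContinuousWithinAt w S t) (ht : 0 < ε t)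
    (hP : ∀ᶠ s in 𝓝[S] t, P F N₁ ξ (ε s) = P F N₁ ξ (ε t)) :
    ContinuousWithinAt (fun s => Phi F N₁ ξ z₀ ε (w s) s) S t := by
  have ha : Continuous fun h : H => ContinuousLinearMap.adjoint (fderiv ℝ F h) (F h) :=
    ((ContinuousLinearMap.adjoint (𝕜 := ℝ) (E := H) (F := H)).continuous.comp
      hF'.continuous).clm_apply hF.continuous
  have hS : ContinuousWithinAt (fun s => TepsInv F (ε s) (w s)) S t :=
    ContinuousAt.comp_continuousWithinAt (g := fun p : ℝ × H => TepsInv F p.1 p.2)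
      (f := fun s => (ε s, w s)) (continuousAt_TepsInv hF' ht (w t)) (hε.prodMk hw)
  have hSa := hS.clm_apply (ha.continuousAt.comp_continuousWithinAt hw)
  have h1 : ContinuousWithinAt (fun s => (P F N₁ ξ (ε t) - 1) (w s - z₀)
      - P F N₁ ξ (ε t) (TepsInv F (ε s) (w s)
        (ContinuousLinearMap.adjoint (fderiv ℝ F (w s)) (F (w s))))) S t :=
    ((P F N₁ ξ (ε t) - 1).continuous.continuousAt.comp_continuousWithinAt
      (hw.sub continuousWithinAt_const)).sub
      ((P F N₁ ξ (ε t)).continuous.continuousAt.comp_continuousWithinAt hSa)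
  refine h1.congr_of_eventuallyEq ?_ rfl
  filter_upwards [hP] with s hs
  rw [Phi, hs]

theorem continuousWithinAt_Ici_Phi (hF_compact : IsCompactMap F) (hF : Differentiable ℝ F)
    (hF' : Differentiable ℝ (fderiv ℝ F)) {ε : ℝ → ℝ} {w : ℝ → H} (ξ z₀ : H)
    (hε : ContinuousOn ε (Ici 0)) (hanti : AntitoneOn ε (Ici 0)) (hpos : ∀ t, 0 ≤ t → 0 < ε t)
    (hw : ContinuousOn w (Ici 0)) {t : ℝ} (ht : 0 ≤ t) :
    ContinuousWithinAt (fun s => Phi F N₁ ξ z₀ ε (w s) s) (Ici t) t := by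
  have hsub : Ici t ⊆ Ici 0 := Ici_subset_Ici.2 ht
  refine continuousWithinAt_Phi hF hF' ξ z₀ ((hε t ht).mono hsub) ((hw t ht).mono hsub)
    (hpos t ht) ?_
  have h1 : Tendsto ε (𝓝[Ici t] t) (𝓝[≤] (ε t)) :=
    tendsto_nhdsWithin_iff.2 ⟨(hε t ht).mono hsub, by
      filter_upwards [self_mem_nhdsWithin] with s hs using hanti ht (hsub hs) hs⟩
  exact h1.eventually (eventually_P_eq_left hF_compact hF N₁ ξ (hpos t ht))

/-- Whenever ‖z − y‖ touches vε, the squared norm has a strictly smaller right derivative than the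
squared barrier. The velocity φ need agree with `Phi` only at contact, so the lemma serves both the
truncated and the original equation. -/
theorem norm_sub_le_mul_of_hasDerivWithinAt (hF : Differentiable ℝ F)
    (hN₁ : ∀ x, ‖fderiv ℝ F x‖ ≤ N₁) (hF' : Differentiable ℝ (fderiv ℝ F))
    (hN₂ : ∀ x, ‖fderiv ℝ (fderiv ℝ F) x‖ ≤ N₂) {y : H} (hy : F y = 0) (ξ z₀ : H)
    {ε : ℝ → ℝ} {C C₀ a v : ℝ} (hpos : ∀ t, 0 ≤ t → 0 < ε t) (hanti : AntitoneOn ε (Ici 0))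
    (hdiff : DifferentiableOn ℝ ε (Ici 0))
    (hC : ∀ t, 0 ≤ t → ‖P F N₁ ξ (ε t) ∘L TepsInv F (ε t) ξ ∘L (T F y - T F ξ)‖ ≤ C)
    (hC₀ : ∀ t, 0 ≤ t → C₀ ≤ (1 / 2 - C) - |derivWithin ε (Ici 0) t| / ε t)
    (ha : ∀ t, 0 ≤ t → ‖(P F N₁ ξ (ε t) - 1) (y - z₀)‖ ≤ a * ε t)
    (hv : 0 < v) (hquad : a - C₀ * v + (4 * N₁ * N₂ + N₂ * √(ε 0)) / 4 * v ^ 2 < 0)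
    {z φ : ℝ → H} (hzc : ContinuousOn z (Ici 0)) (h0 : ‖z 0 - y‖ ≤ v * ε 0)
    (hz : ∀ t, 0 ≤ t → HasDerivWithinAt z (φ t) (Ici t) t)
    (hφ : ∀ t, 0 ≤ t → ‖z t - y‖ = v * ε t → φ t = Phi F N₁ ξ z₀ ε (z t) t)
    {t : ℝ} (ht : 0 ≤ t) : ‖z t - y‖ ≤ v * ε t := by
  have hN20 : 0 ≤ N₂ := (norm_nonneg (fderiv ℝ (fderiv ℝ F) y)).trans (hN₂ y)
  have hεc : ContinuousOn ε (Ici 0) := hdiff.continuousOn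
  have key := image_le_of_deriv_right_lt_deriv_boundary' (a := 0) (b := t)
    (f := fun s => ‖z s - y‖ ^ 2) (f' := fun s => 2 * ⟪z s - y, φ s⟫)
    (B := fun s => (v * ε s) ^ 2)
    (B' := fun s => 2 * (v * ε s) * (v * derivWithin ε (Ici 0) s))
    (((hzc.mono Icc_subset_Ici_self).sub continuousOn_const).norm.pow 2)
    (fun s hs => ((hz s hs.1).sub_const y).norm_sq)
    (pow_le_pow_left₀ (norm_nonneg _) h0 2)
    ((continuousOn_const.mul (hεc.mono Icc_subset_Ici_self)).pow 2)
    (fun s hs => by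
      have h1 := ((hdiff s hs.1).hasDerivWithinAt.mono (Ici_subset_Ici.2 hs.1)).const_mul v
      exact (h1.pow 2).congr_deriv (by norm_num))
    (fun s hs heq => by
      have hes := hpos s hs.1
      have hn : ‖z s - y‖ = v * ε s :=
        (pow_left_inj₀ (norm_nonneg _) (by positivity) two_ne_zero).1 heq
      have h1 := inner_sub_field_le hF hN₁ hF' hN₂ hy ξ z₀ (z s) hes (hC s hs.1)
      change ⟪z s - y, Phi F N₁ ξ z₀ ε (z s) s⟫ ≤ _ at h1
      rw [← hφ s hs.1 hn, hn] at h1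
      have h2 : √(ε s) ≤ √(ε 0) := Real.sqrt_le_sqrt (hanti (mem_Ici.2 le_rfl) hs.1 hs.1)
      have h3 : -((1 / 2 - C - C₀) * ε s) ≤ derivWithin ε (Ici 0) s := by
        have h4 : |derivWithin ε (Ici 0) s| / ε s ≤ 1 / 2 - C - C₀ := by linarith [hC₀ s hs.1]
        rw [div_le_iff₀ hes] at h4
        linarith [neg_abs_le (derivWithin ε (Ici 0) s)]
      have h5 : (4 * N₁ * N₂ + N₂ * √(ε s)) / (4 * ε s) * (v * ε s) ^ 2 ≤
          (4 * N₁ * N₂ + N₂ * √(ε 0)) / 4 * v ^ 2 * ε s := by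
        have : (4 * N₁ * N₂ + N₂ * √(ε s)) / (4 * ε s) * (v * ε s) ^ 2 =
          (4 * N₁ * N₂ + N₂ * √(ε s)) / 4 * v ^ 2 * ε s := by field_simp
        rw [this]; gcongr
      -- The part of γ exceeding C₀ absorbs the decay of ε; what remains is ε(s) times the negative
      -- quadratic in v.
      have h6 : ‖(P F N₁ ξ (ε s) - 1) (y - z₀)‖ - (1 / 2 - C) * (v * ε s)
          + (4 * N₁ * N₂ + N₂ * √(ε s)) / (4 * ε s) * (v * ε s) ^ 2 <
          v * derivWithin ε (Ici 0) s := by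
        have h7 := mul_le_mul_of_nonneg_left h3 hv.le
        have h8 := mul_neg_of_neg_of_pos hquad hes
        linarith [ha s hs.1]
      have h9 := mul_lt_mul_of_pos_left h6 (mul_pos hv hes)
      linarith)
  exact (pow_le_pow_iff_left₀ (norm_nonneg _) (mul_pos hv (hpos t ht)).le two_ne_zero).1
    (key (right_mem_Icc.2 ht))

end Dynamics

end GaussNewton

/-! ### The main theorem. -/

theorem theorem4p1 {H : Type*} [NormedAddCommGroup H] [InnerProductSpace ℝ H] [CompleteSpace H]
    (F : H → H) (y z₀ ξ : H) (N₁ N₂ ε₀ C C₀ Cα : ℝ) (ε : ℝ → ℝ)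
    -- `y` is the unique solution of `F(z) = 0`
    (hy : F y = 0) (hy_unique : ∀ x, F x = 0 → x = y)
    -- `F` is compact and twice Fréchet differentiable with bounded derivatives
    (hF_compact : GaussNewton.IsCompactMap F)
    (hF : Differentiable ℝ F) (hF' : Differentiable ℝ (fderiv ℝ F))
    (hN₁ : ∀ x, ‖fderiv ℝ F x‖ ≤ N₁)
    (hN₂ : ∀ x, ‖fderiv ℝ (fderiv ℝ F) x‖ ≤ N₂) (hN₂_pos : 0 < N₂)
    -- smallness condition
    (hε₀ : 0 < ε₀)
    (hC : IsLUB ((fun e : ℝ => ‖GaussNewton.P F N₁ ξ e ∘L GaussNewton.TepsInv F e ξ ∘L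
      (GaussNewton.T F y - GaussNewton.T F ξ)‖) '' Set.Ioc 0 ε₀) C)
    (hC_lt : C < 1 / 2)
    (hε_pos : ∀ t, 0 ≤ t → 0 < ε t) (hε_le : ∀ t, 0 ≤ t → ε t ≤ ε₀)
    -- condition 1: `y - z₀` is orthogonal to the null space of `T(ξ)`
    (hker : (GaussNewton.T F ξ).ker.starProjection (y - z₀) = 0)
    -- condition 2
    (hε_smooth : ContDiffOn ℝ 1 ε (Set.Ici 0)) (hε_anti : AntitoneOn ε (Set.Ici 0))
    (hε_lim : Filter.Tendsto ε Filter.atTop (nhds 0))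
    (hC₀ : IsGLB ((fun t : ℝ => (1 / 2 - C) - |derivWithin ε (Set.Ici 0) t| / ε t) '' Set.Ici 0) C₀)
    (hC₀_pos : 0 < C₀)
    -- condition 3
    (hCα : IsLUB ((fun t : ℝ =>
      ε 0 * (‖(GaussNewton.P F N₁ ξ (ε t) - 1) (y - z₀)‖ / ε t)) '' Set.Ici 0) Cα)
    -- condition 4, multiplied out so that a vanishing `Cα` or `‖y - z₀‖` imposes no constraint
    (hsmall₁ : (4 * N₁ * N₂ + N₂ * √(ε 0)) / (2 * C₀) * (2 * Cα) < ε 0 * C₀)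
    (hsmall₂ : (4 * N₁ * N₂ + N₂ * √(ε 0)) / (2 * C₀) * ‖y - z₀‖ < ε 0) :
    ∃ z : ℝ → H,
      GaussNewton.IsSolution (GaussNewton.Phi F N₁ ξ z₀ ε) z₀ z ∧
      (∀ w : ℝ → H, GaussNewton.IsSolution (GaussNewton.Phi F N₁ ξ z₀ ε) z₀ w →
        Set.EqOn w z (Set.Ici 0)) ∧
      -- the differential equation holds pointwise: with the right derivative at every `t ≥ 0`, and
      -- with the two-sided one at every `t > 0` for which `ε(t)` is not an eigenvalue of `T(ξ)`
      (∀ t, 0 ≤ t → HasDerivWithinAt z (GaussNewton.Phi F N₁ ξ z₀ ε (z t) t) (Set.Ici t) t) ∧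
      (∀ t, 0 < t → ¬ Module.End.HasEigenvalue (GaussNewton.T F ξ : H →ₗ[ℝ] H) (ε t) →
        HasDerivAt z (GaussNewton.Phi F N₁ ξ z₀ ε (z t) t) t) ∧
      ∀ t, 0 ≤ t → ‖z t - y‖ ≤ 2 * C₀ / (4 * N₁ * N₂ + N₂ * √(ε 0)) * ε t := by
  have hεc : ContinuousOn ε (Ici 0) := hε_smooth.continuousOn
  have hε0 : 0 < ε 0 := hε_pos 0 le_rfl
  have hN₁0 : 0 ≤ N₁ := (norm_nonneg _).trans (hN₁ y)
  set M := 4 * N₁ * N₂ + N₂ * √(ε 0) with hM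
  have hM0 : 0 < M := by
    have : 0 < √(ε 0) := Real.sqrt_pos.2 hε0
    positivity
  set v := 2 * C₀ / M with hv
  have hv0 : 0 < v := by positivity
  have hR0 : 0 < v * ε 0 := mul_pos hv0 hε0
  have hCt : ∀ t, 0 ≤ t → ‖GaussNewton.P F N₁ ξ (ε t) ∘L GaussNewton.TepsInv F (ε t) ξ ∘L
      (GaussNewton.T F y - GaussNewton.T F ξ)‖ ≤ C := fun t ht =>
    hC.1 ⟨ε t, ⟨hε_pos t ht, hε_le t ht⟩, rfl⟩
  have hC₀t : ∀ t, 0 ≤ t → C₀ ≤ (1 / 2 - C) - |derivWithin ε (Ici 0) t| / ε t := fun t ht =>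
    hC₀.1 ⟨t, ht, rfl⟩
  have hα : ∀ t, 0 ≤ t →
      ‖(GaussNewton.P F N₁ ξ (ε t) - 1) (y - z₀)‖ ≤ Cα / ε 0 * ε t := fun t ht => by
    have h1 : ε 0 * (‖(GaussNewton.P F N₁ ξ (ε t) - 1) (y - z₀)‖ / ε t) ≤ Cα :=
      hCα.1 ⟨t, ht, rfl⟩
    rwa [← div_le_iff₀ (hε_pos t ht), le_div_iff₀ hε0, mul_comm]
  -- v = 2C₀/M minimises this quadratic; its minimum Cα/ε(0) − C₀²/M is negative exactly by the
  -- first half of condition 4. The second half puts z₀ under the barrier.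
  have hquad : Cα / ε 0 - C₀ * v + M / 4 * v ^ 2 < 0 := by
    have h1 : M * Cα < ε 0 * C₀ * C₀ := by
      have : M / (2 * C₀) * (2 * Cα) = M * Cα / C₀ := by field_simp
      rwa [this, div_lt_iff₀ hC₀_pos] at hsmall₁
    have h2 : Cα / ε 0 < C₀ * C₀ / M := by
      rw [div_lt_div_iff₀ hε0 hM0]; linarith
    have h3 : C₀ * v - M / 4 * v ^ 2 = C₀ * C₀ / M := by rw [hv]; field_simp; ring
    linarith
  have hinit : ‖z₀ - y‖ ≤ v * ε 0 := by
    rw [norm_sub_rev]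
    have h1 : ‖y - z₀‖ = v * (M / (2 * C₀) * ‖y - z₀‖) := by rw [hv]; field_simp
    rw [h1]
    exact mul_le_mul_of_nonneg_left hsmall₂.le hv0.le
  have hball : ∀ t, 0 ≤ t → v * ε t ≤ v * ε 0 := fun t ht =>
    mul_le_mul_of_nonneg_left (hε_anti (mem_Ici.2 le_rfl) ht ht) hv0.le
  have hapriori : ∀ z φ : ℝ → H, ContinuousOn z (Ici 0) → z 0 = z₀ →
      (∀ t, 0 ≤ t → HasDerivWithinAt z (φ t) (Ici t) t) →
      (∀ t, 0 ≤ t → ‖z t - y‖ = v * ε t → φ t = GaussNewton.Phi F N₁ ξ z₀ ε (z t) t) →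
      ∀ t, 0 ≤ t → ‖z t - y‖ ≤ v * ε t := fun z φ hzc h0 hz hφ t ht =>
    GaussNewton.norm_sub_le_mul_of_hasDerivWithinAt hF hN₁ hF' hN₂ hy ξ z₀ hε_pos hε_anti
      (hε_smooth.differentiableOn one_ne_zero) hCt hC₀t hα hv0 hquad hzc (h0 ▸ hinit) hz hφ ht
  have hcontΦ : ∀ u : ℝ → H, ContinuousOn u (Ici 0) → ∀ t, 0 ≤ t →
      ContinuousWithinAt (fun s => GaussNewton.Phi F N₁ ξ z₀ ε (u s) s) (Ici t) t :=
    fun u hu t ht => GaussNewton.continuousWithinAt_Ici_Phi hF_compact hF hF' ξ z₀ hεc hε_anti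
      hε_pos hu ht
  have hlip : ∀ b, 0 ≤ b → ∃ L, 0 ≤ L ∧ ∀ t ∈ Icc 0 b, ∀ h h' : H, ‖h - y‖ ≤ v * ε 0 →
      ‖h' - y‖ ≤ v * ε 0 → ‖GaussNewton.Phi F N₁ ξ z₀ ε h t - GaussNewton.Phi F N₁ ξ z₀ ε h' t‖
        ≤ L * ‖h - h'‖ := fun b hb => by
    obtain ⟨L, hL0, hL⟩ := GaussNewton.exists_lipschitz_field hF hN₁ hF' hN₂ hy ξ z₀
      (hε_pos b hb) hR0.le
    exact ⟨L, hL0, fun t ht => hL (ε t) (hε_anti ht.1 hb ht.2)⟩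
  have hderiv : ∀ w, GaussNewton.IsSolution (GaussNewton.Phi F N₁ ξ z₀ ε) z₀ w → ∀ t, 0 ≤ t →
      HasDerivWithinAt w (GaussNewton.Phi F N₁ ξ z₀ ε (w t) t) (Ici t) t := fun w hw t ht =>
    GaussNewton.hasDerivWithinAt_Ici_of_eq_integral hw.eq_integral hw.integrable
      (hcontΦ w hw.continuousOn) ht
  have hinit_eq : ∀ w, GaussNewton.IsSolution (GaussNewton.Phi F N₁ ξ z₀ ε) z₀ w → w 0 = z₀ :=
    fun w hw => by simpa using hw.eq_integral 0 le_rfl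
  have hbound : ∀ w, GaussNewton.IsSolution (GaussNewton.Phi F N₁ ξ z₀ ε) z₀ w → ∀ t, 0 ≤ t →
      ‖w t - y‖ ≤ v * ε t := fun w hw =>
    hapriori w _ hw.continuousOn (hinit_eq w hw) (hderiv w hw) fun _ _ _ => rfl
  -- the field truncated to the ball in which solutions stay
  let π : H → H := GaussNewton.radialRetraction y (v * ε 0)
  have hπc : Continuous π := GaussNewton.continuous_radialRetraction y hR0
  have hπ_ball : ∀ x, ‖π x - y‖ ≤ v * ε 0 := GaussNewton.norm_radialRetraction_sub_le y hR0
  have hcontΨ : ∀ u : ℝ → H, ContinuousOn u (Ici 0) → ∀ t, 0 ≤ t →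
      ContinuousWithinAt (fun s => GaussNewton.Phi F N₁ ξ z₀ ε (π (u s)) s) (Ici t) t :=
    fun u hu => hcontΦ (fun s => π (u s)) (hπc.comp_continuousOn hu)
  have hbdΨ : ∀ b, 0 ≤ b → ∃ B, 0 ≤ B ∧ ∀ t ∈ Icc 0 b, ∀ x,
      ‖GaussNewton.Phi F N₁ ξ z₀ ε (π x) t‖ ≤ B := fun b hb => by
    have hb' := hε_pos b hb
    exact ⟨v * ε 0 + ‖y - z₀‖ + (ε b)⁻¹ * (N₁ * (N₁ * (v * ε 0))), by positivity,
      fun t ht x => GaussNewton.norm_field_le hF hN₁ hy ξ z₀ hb' (hε_anti ht.1 hb ht.2) (hπ_ball x)⟩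
  obtain ⟨z, hzc, hz_eq⟩ := GaussNewton.exists_integral_solution
    (G := fun x t => GaussNewton.Phi F N₁ ξ z₀ ε (π x) t) z₀ hcontΨ
    (fun b hb => by
      obtain ⟨L, hL0, hL⟩ := hlip b hb
      refine ⟨L * 2, by positivity, fun t ht x x' =>
        (hL t ht _ _ (hπ_ball x) (hπ_ball x')).trans ?_⟩
      rw [mul_assoc]
      exact mul_le_mul_of_nonneg_left
        (GaussNewton.norm_radialRetraction_sub_radialRetraction_le y hR0 x x') hL0) hbdΨ
  have hintΨ : ∀ t, 0 ≤ t →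
      IntervalIntegrable (fun s => GaussNewton.Phi F N₁ ξ z₀ ε (π (z s)) s) volume 0 t :=
    fun t ht => by
      obtain ⟨B, -, hB⟩ := hbdΨ t ht
      exact GaussNewton.intervalIntegrable_of_norm_le (hcontΨ z hzc) ht fun s hs => hB s hs _
  have hπ_eq : ∀ t, 0 ≤ t → ‖z t - y‖ ≤ v * ε t → π (z t) = z t := fun t ht h =>
    GaussNewton.radialRetraction_eq_self y hR0 (h.trans (hball t ht))
  have hz_bound : ∀ t, 0 ≤ t → ‖z t - y‖ ≤ v * ε t :=
    hapriori z (fun t => GaussNewton.Phi F N₁ ξ z₀ ε (π (z t)) t) hzc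
      (by simpa using hz_eq 0 le_rfl)
      (fun t ht => GaussNewton.hasDerivWithinAt_Ici_of_eq_integral hz_eq hintΨ (hcontΨ z hzc) ht)
      -- At contact, vε(t) ≤ vε(0), so the point lies in the truncation ball and is fixed by π.
      (fun t ht h => by simp only [hπ_eq t ht h.le])
  have hΨΦ : ∀ t, 0 ≤ t → EqOn (fun s => GaussNewton.Phi F N₁ ξ z₀ ε (π (z s)) s)
      (fun s => GaussNewton.Phi F N₁ ξ z₀ ε (z s) s) (uIcc 0 t) := fun t ht s hs => by
    rw [uIcc_of_le ht] at hs
    simp only [hπ_eq s hs.1 (hz_bound s hs.1)]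
  have hz_sol : GaussNewton.IsSolution (GaussNewton.Phi F N₁ ξ z₀ ε) z₀ z :=
    ⟨hzc, fun t ht => (hintΨ t ht).congr fun s hs => hΨΦ t ht (uIoc_subset_uIcc hs),
      fun t ht => by rw [hz_eq t ht, intervalIntegral.integral_congr (hΨΦ t ht)]⟩
  refine ⟨z, hz_sol, fun w hw t ht => ?_, hderiv z hz_sol, fun t ht hne => ?_, hz_bound⟩
  · obtain ⟨L, hL0, hL⟩ := hlip t ht
    -- This Grönwall argument needs only right derivatives, which both solutions have everywhere
    -- despite the jumps of the field.
    refine ODE_solution_unique_of_mem_Icc_right (a := 0) (b := t) (K := ⟨L, hL0⟩)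
      (v := fun t h => GaussNewton.Phi F N₁ ξ z₀ ε h t)
      (s := fun _ => {h | ‖h - y‖ ≤ v * ε 0})
      (fun s hs => LipschitzOnWith.of_dist_le_mul fun h hh h' hh' => ?_)
      (hw.continuousOn.mono Icc_subset_Ici_self) (fun s hs => hderiv w hw s hs.1)
      (fun s hs => (hbound w hw s hs.1).trans (hball s hs.1))
      (hzc.mono Icc_subset_Ici_self) (fun s hs => hderiv z hz_sol s hs.1)
      (fun s hs => (hz_bound s hs.1).trans (hball s hs.1))
      ((hinit_eq w hw).trans (hinit_eq z hz_sol).symm) (right_mem_Icc.2 ht)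
    rw [dist_eq_norm, dist_eq_norm]
    exact hL s ⟨hs.1, hs.2.le⟩ h h' hh hh'
  · have hnhds : Ici (0 : ℝ) ∈ 𝓝 t := Ici_mem_nhds ht
    have hεt : ContinuousAt ε t := hεc.continuousAt hnhds
    refine GaussNewton.hasDerivAt_of_eq_integral hz_sol.eq_integral hz_sol.integrable
      (hcontΦ z hzc) ht (continuousWithinAt_univ _ _ |>.1 ?_)
    refine GaussNewton.continuousWithinAt_Phi hF hF' ξ z₀ hεt.continuousWithinAt
      (hzc.continuousAt hnhds).continuousWithinAt (hε_pos t ht.le) ?_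
    rw [nhdsWithin_univ]
    exact hεt.eventually
      (GaussNewton.eventually_P_eq hF_compact hF N₁ ξ (hε_pos t ht.le) hne)
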